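/- Let $p,q\ge 2$ be integers. \emph{Hypergraphs.} A hypergraph $H$ is a pair $(V,E)$ with $V$ a finite set and $E$ a collection of subsets of $V$. A transversal of $H$ is a set $C\subseteq V$ that meets every edge, and a matching is a set of pairwise disjoint edges; $\tau(H)$ denotes the minimum size of a transversal and $\nu(H)$ the maximum size of a matching. For disjoint $W,Z\subseteq V$, the minor $H\backslash W/Z$ is the hypergraph with vertex set $V\setminus(W\cup Z)$ and edge set $\{e\setminus Z : e\in E,\ e\cap W=\emptyset\}$ ($W=Z=\emptyset$ is allowed). $H$ packs if $\tau(H)=\nu(H)$; by convention, $H$ also packs if $\emptyset\in E$ (in which case there is no transversal). $H$ has the packing property if each of its minors packs. \emph{The hypergraphs $Q_{pq}^F$.} Let $V_{pq}$ be the set of $2(p+q+1)$ distinct vertices in $P=\{p_1,\dots,p_p\}$, $P^*=\{p_1^*,\dots,p_p^*\}$, $Q=\{q_1,\dots,q_q\}$, $Q^*=\{q_1^*,\dots,q_q^*\}$, $\{r\}$, $\{r^*\}$, with the involution $v\leftrightarrow v^*$. For $S\subseteq V_{pq}$ put $S^*=\{v^*: v\in S\}$, and for a family $F$ of subsets of $V_{pq}$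 put $F^*=\{f^*: f\in F\}$. Let $E_{pq}$ consist of the sets $$A\cup(P\setminus A)^*\cup Q\cup\{r\},\qquad (P\setminus A)\cup A^*\cup Q^*\cup\{r\}\qquad(\emptyset\ne A\subseteq P),$$ $$P\cup(Q\setminus B)\cup B^*\cup\{r^*\},\qquad P^*\cup B\cup(Q\setminus B)^*\cup\{r^*\}\qquad(\emptyset\neq B\subseteq Q),$$ let $$F_{pq}=\bigl\{P\cup Q\cup\{r\},\ P^*\cup Q^*\cup\{r\},\ P\cup Q^*\cup\{r^*\},\ P^*\cup Q\cup\{r^*\}\bigr\}\subseteq E_{pq},$$ and for $F\subseteq (E_{pq})^*$ let $Q_{pq}^F=(V_{pq},\,E_{pq}\cup F)$. \textbf{Theorem.} The hypergraph $Q_{pq}^F$ has the packing property in each of the following two cases: (I) $F\subseteq (F_{pq})^*$ and $F\neq\emptyset$; (II) $F=(E_{pq}\setminus F')^*$ for some $F'\subseteq F_{pq}$ with $F'\neq\emptyset$. -/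

import Mathlib

namespace Hypergraph

/-- Deletion of a set `W` of vertices: the edges that meet `W` are removed. -/
def delete {α : Type*} (H : Hypergraph α) (W : Set α) : Hypergraph α where
  vertexSet := H.vertexSet \ W
  edgeSet := {e | e ∈ H.edgeSet ∧ Disjoint e W}
  subset_vertexSet_of_mem_edgeSet' := fun _ he =>
    Set.subset_sdiff.2 ⟨H.subset_vertexSet_of_mem_edgeSet' he.1, he.2⟩

/-- Contraction of a set `Z` of vertices: the vertices of `Z` are removed from every edge. -/
def contract {α : Type*} (H : Hypergraph α) (Z : Set α) : Hypergraph α where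
  vertexSet := H.vertexSet \ Z
  edgeSet := (fun e => e \ Z) '' H.edgeSet
  subset_vertexSet_of_mem_edgeSet' := by
    rintro _ ⟨e, he, rfl⟩
    exact Set.sdiff_subset_sdiff_left (H.subset_vertexSet_of_mem_edgeSet' he)

/-- `H'` is a minor of `H`: it is obtained by deleting the vertices of a set `W` and contracting
the vertices of a set `Z`, where `W` and `Z` are disjoint (both may be empty). -/
def IsMinor {α : Type*} (H' H : Hypergraph α) : Prop :=
  ∃ W Z : Set α, W ⊆ H.vertexSet ∧ Z ⊆ H.vertexSet ∧ Disjoint W Z ∧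
    H' = (H.delete W).contract Z

/-- A vertex cover (transversal): a set of vertices that meets every edge. -/
def IsTransversal {α : Type*} (H : Hypergraph α) (C : Set α) : Prop :=
  C ⊆ H.vertexSet ∧ ∀ e ∈ H.edgeSet, (C ∩ e).Nonempty

/-- A matching: a set of pairwise disjoint edges. -/
def IsMatching {α : Type*} (H : Hypergraph α) (M : Set (Set α)) : Prop :=
  M ⊆ H.edgeSet ∧ M.PairwiseDisjoint id

/-- `τ(H)`, the minimum size of a vertex cover (`⊤` if there is none, which for a finite vertex
set means that the empty set is an edge). -/
noncomputable def coverNumber {α : Type*} (H : Hypergraph α) : ℕ∞ :=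
  ⨅ (C : Set α) (_ : H.IsTransversal C), C.encard

/-- `ν(H)`, the maximum size of a matching. -/
noncomputable def matchingNumber {α : Type*} (H : Hypergraph α) : ℕ∞ :=
  ⨆ (M : Set (Set α)) (_ : H.IsMatching M), M.encard

/-- The König property: `τ(H) = ν(H)`. A hypergraph one of whose edges is empty has no vertex
cover; by convention it packs. -/
def Packs {α : Type*} (H : Hypergraph α) : Prop :=
  ∅ ∈ H.edgeSet ∨ H.coverNumber = H.matchingNumber

/-- The packing property: every minor packs. -/
def HasPackingProperty {α : Type*} (H : Hypergraph α) : Prop :=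
  ∀ H' : Hypergraph α, H'.IsMinor H → H'.Packs

end Hypergraph

namespace QClutter

/-- The vertices `p₁,…,p_p, q₁,…,q_q, r` (second component `false`) and their starred copies
(second component `true`). -/
abbrev Vertex (p q : ℕ) : Type := (Fin p ⊕ Fin q ⊕ Unit) × Bool

/-- The involution `v ↦ v*`. -/
def star {p q : ℕ} (v : Vertex p q) : Vertex p q := (v.1, !v.2)

/-- `S* = {v* : v ∈ S}` for a set `S` of vertices. -/
def starSet {p q : ℕ} (S : Set (Vertex p q)) : Set (Vertex p q) := star '' S

/-- `F* = {f* : f ∈ F}` for a family `F` of sets of vertices. -/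
def starFamily {p q : ℕ} (F : Set (Set (Vertex p q))) : Set (Set (Vertex p q)) := starSet '' F

/-- The set of unstarred vertices `pᵢ` with `i ∈ A`. -/
def pSet {p : ℕ} (q : ℕ) (A : Set (Fin p)) : Set (Vertex p q) :=
  (fun i => (Sum.inl i, false)) '' A

/-- The set of unstarred vertices `qⱼ` with `j ∈ B`. -/
def qSet (p : ℕ) {q : ℕ} (B : Set (Fin q)) : Set (Vertex p q) :=
  (fun j => (Sum.inr (Sum.inl j), false)) '' B

/-- The block `P`. -/
def P (p q : ℕ) : Set (Vertex p q) := pSet q Set.univ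

/-- The block `Q`. -/
def Q (p q : ℕ) : Set (Vertex p q) := qSet p Set.univ

/-- The block `{r}`. -/
def R (p q : ℕ) : Set (Vertex p q) := {(Sum.inr (Sum.inr ()), false)}

/-- The edge set `E_{pq}` of `Q_{pq}`; the four parts are the four row blocks of the transposed
incidence matrix. -/
def edges (p q : ℕ) : Set (Set (Vertex p q)) :=
  {e | ∃ A : Set (Fin p), A.Nonempty ∧
      e = pSet q A ∪ starSet (pSet q Aᶜ) ∪ Q p q ∪ R p q} ∪
  {e | ∃ A : Set (Fin p), A.Nonempty ∧
      e = pSet q Aᶜ ∪ starSet (pSet q A) ∪ starSet (Q p q) ∪ R p q} ∪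
  {e | ∃ B : Set (Fin q), B.Nonempty ∧
      e = P p q ∪ qSet p Bᶜ ∪ starSet (qSet p B) ∪ starSet (R p q)} ∪
  {e | ∃ B : Set (Fin q), B.Nonempty ∧
      e = starSet (P p q) ∪ qSet p B ∪ starSet (qSet p Bᶜ) ∪ starSet (R p q)}

/-- `F_{pq} = {PQr, P*Q*r, PQ*r*, P*Qr*}`. -/
def specialEdges (p q : ℕ) : Set (Set (Vertex p q)) :=
  {P p q ∪ Q p q ∪ R p q,
   starSet (P p q) ∪ starSet (Q p q) ∪ R p q,
   P p q ∪ starSet (Q p q) ∪ starSet (R p q),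
   starSet (P p q) ∪ Q p q ∪ starSet (R p q)}

/-- The hypergraph `Q_{pq}^F = (V_{pq}, E_{pq} ∪ F)`. -/
def QF (p q : ℕ) (F : Set (Set (Vertex p q))) : Hypergraph (Vertex p q) where
  vertexSet := Set.univ
  edgeSet := edges p q ∪ F
  subset_vertexSet_of_mem_edgeSet' := fun _ _ => Set.subset_univ _

end QClutter

/-! Read the star as the bit `true`. Every edge takes one vertex from each pair `v, v*`, so it is a
point `(a, b, c)` of a cube with two blocks and a last coordinate. Membership depends only on `c`
and on which constants, if any, `a` and `b` are (`pattern`). Even corners, the members of `F_{pq}`,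
are always present; odd corners are their antipodes.

Packing is witnessed by pairing disjoint edges with vertices that meet every edge. An induction over
deletions reduces everything to minors in which a deleted vertex has a contracted antipode, every
other vertex is on a surviving edge, and no edge has fewer than two vertices
(`minor_certified_of_reduced`).

Suppose some coordinate has no contracted vertex. Its two vertices form a cover, so two disjoint
edges suffice (`IsReduced.exists_disjoint`). Deletions restrict the points to a face of the cube,
and the surviving points take both values in each free coordinate of it. Two of them must differ in
all free coordinates. Only the shape of each block matters, so this is a finite check, uniform in
`p` and `q`. In case (I) it needs `F ≠ ∅`: in the whole cube, only opposite corners can form such a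
pair, and they have opposite parity.

Otherwise the contracted vertices contain a whole point of the cube. Points differing from it in at
most one coordinate cannot survive, since their edges would be too small. These absences leave so
few possibilities that a cover and a matching, of size at most four, can be written down according
to which contracted blocks are constant. -/

namespace QClutter

open Set

/-! ### Certificates for packing -/

/-- A certificate that a family of sets packs: a list of pairs (vertex, edge) such that the edges
are pairwise disjoint and the vertices meet every edge. -/
def Certified {V : Type*} (E : Set (Set V)) : Prop :=
  ∃ L : List (V × Set V), (∀ x ∈ L, x.2 ∈ E) ∧ L.Pairwise (fun x y => Disjoint x.2 y.2) ∧
    ∀ e ∈ E, ∃ x ∈ L, x.1 ∈ e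

/-- Pairs whose second component is not an edge may be dropped from a certificate. -/
theorem Certified.of_list {V : Type*} {E : Set (Set V)} (L : List (V × Set V))
    (hd : L.Pairwise (fun x y => Disjoint x.2 y.2))
    (hc : ∀ e ∈ E, ∃ x ∈ L, x.1 ∈ e ∧ x.2 ∈ E) : Certified E := by
  classical
  refine ⟨L.filter (fun x => x.2 ∈ E), ?_, hd.filter _, ?_⟩
  · intro x hx
    simpa using (List.mem_filter.1 hx).2
  · intro e he
    obtain ⟨x, hx, hxe, hxE⟩ := hc e he
    exact ⟨x, List.mem_filter.2 ⟨hx, by simpa using hxE⟩, hxe⟩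

theorem matchingNumber_le_coverNumber {V : Type*} (H : Hypergraph V) :
    H.matchingNumber ≤ H.coverNumber := by
  refine iSup₂_le fun M hM => le_iInf₂ fun C hC => ?_
  rcases M.eq_empty_or_nonempty with rfl | ⟨e₀, he₀⟩
  · simp
  have : Nonempty V := ⟨(hC.2 e₀ (hM.1 he₀)).some⟩
  choose! f hf using fun e (he : e ∈ M) => hC.2 e (hM.1 he)
  refine Set.encard_le_encard_of_injOn (f := f) (fun e he => (hf e he).1) ?_
  intro e he e' he' h
  by_contra hne
  exact Set.disjoint_left.1 (hM.2 he he' hne) (hf e he).2 (h ▸ (hf e' he').2)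

theorem packs_of_certified {V : Type*} (H : Hypergraph V)
    (h : ∅ ∈ H.edgeSet ∨ Certified H.edgeSet) : H.Packs := by
  classical
  by_cases h0 : ∅ ∈ H.edgeSet
  · exact Or.inl h0
  obtain ⟨L, hL, hd, hc⟩ := h.resolve_left h0
  refine Or.inr (le_antisymm ?_ (matchingNumber_le_coverNumber H))
  -- Two equal entries would be disjoint from each other, hence empty; but `∅` is not an edge.
  have hnd : (L.map Prod.snd).Nodup := by
    rw [List.nodup_iff_pairwise_ne, List.pairwise_map]
    refine hd.imp_of_mem fun {x y} hx _ hxy heq => h0 ?_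
    rw [← heq, disjoint_self] at hxy
    exact (show x.2 = ∅ from hxy) ▸ hL x hx
  have hM : H.IsMatching ((L.map Prod.snd).toFinset : Set (Set V)) := by
    constructor
    · intro e he
      simp only [List.coe_toFinset, List.mem_map, mem_ofPred_eq] at he
      obtain ⟨x, hx, rfl⟩ := he
      exact hL x hx
    · intro e he e' he' hne
      simp only [List.coe_toFinset, List.mem_map, mem_ofPred_eq] at he he'
      obtain ⟨x, hx, rfl⟩ := he
      obtain ⟨y, hy, rfl⟩ := he'
      have : Std.Symm fun x y : V × Set V => Disjoint x.2 y.2 := ⟨fun _ _ h => h.symm⟩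
      exact hd.forall hx hy (fun h => hne (h ▸ rfl))
  -- A certificate does not ask its vertices to lie in the vertex set; those outside meet no edge
  -- and can be discarded.
  have hC : H.IsTransversal (((L.map Prod.fst).toFinset : Set V) ∩ H.vertexSet) := by
    refine ⟨inter_subset_right, fun e he => ?_⟩
    obtain ⟨x, hx, hxe⟩ := hc e he
    refine ⟨x.1, ⟨?_, H.subset_vertexSet_of_mem_edgeSet' he hxe⟩, hxe⟩
    simp only [List.coe_toFinset, List.mem_map, mem_ofPred_eq]
    exact ⟨x, hx, rfl⟩
  calc H.coverNumber ≤ (((L.map Prod.fst).toFinset : Set V) ∩ H.vertexSet).encard :=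
        iInf₂_le _ hC
    _ ≤ ((L.map Prod.fst).toFinset : Set V).encard := Set.encard_le_encard inter_subset_left
    _ ≤ ((L.map Prod.snd).toFinset : Set (Set V)).encard := by
        rw [Set.encard_coe_eq_coe_finsetCard, Set.encard_coe_eq_coe_finsetCard,
          List.toFinset_card_of_nodup hnd, Nat.cast_le, List.length_map]
        exact (List.toFinset_card_le _).trans (List.length_map _).le
    _ ≤ H.matchingNumber := le_iSup₂ (f := fun M (_ : H.IsMatching M) => M.encard) _ hM

/-! ### Minors of cuboids -/

/-- The edges of the minor obtained by deleting `W` and contracting `Z`. -/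
def minorEdges {V : Type*} (E : Set (Set V)) (W Z : Set V) : Set (Set V) :=
  (fun e => e \ Z) '' {e | e ∈ E ∧ Disjoint e W}

/-- Antipode of a vertex of a cuboid. -/
def antipode {ι : Type*} (v : ι × Bool) : ι × Bool := (v.1, !v.2)

/-- A reduced minor of a cuboid: a deleted vertex has a contracted antipode, every other vertex
lies on a surviving edge, some edge survives, and no edge of the minor has at most one vertex. -/
structure IsReduced {ι : Type*} (E : Set (Set (ι × Bool))) (W Z : Set (ι × Bool)) : Prop where
  disjoint : Disjoint W Z
  antipode_mem : ∀ v ∈ W, antipode v ∈ Z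
  exists_edge : ∀ v ∉ W, ∃ e ∈ E, Disjoint e W ∧ v ∈ e
  nonempty : (minorEdges E W Z).Nonempty
  nontrivial : ∀ e ∈ minorEdges E W Z, ∀ v, ¬ e ⊆ {v}

/-- Every failure of `IsReduced` is harmless. If `{v}` is an edge, delete `v` and add the pair `(v,
{v})` to the certificate. A vertex on no surviving edge may as well be deleted. If `v` is deleted
and its antipode is not contracted, the antipode lies on every edge, and one edge suffices. The
induction is on the number of undeleted vertices, contracted ones included. -/
theorem minor_certified_of_reduced {ι : Type*} [Finite ι] {E : Set (Set (ι × Bool))}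
    (hE : ∀ e ∈ E, ∀ v, v ∉ e → antipode v ∈ e)
    (key : ∀ W Z, IsReduced E W Z → Certified (minorEdges E W Z)) (W Z : Set (ι × Bool))
    (hWZ : Disjoint W Z) : ∅ ∈ minorEdges E W Z ∨ Certified (minorEdges E W Z) := by
  induction hn : Wᶜ.ncard using Nat.strong_induction_on generalizing W Z with
  | _ n ih =>
  subst hn
  have hlt : ∀ v ∉ W, (insert v W)ᶜ.ncard < Wᶜ.ncard := fun v hv =>
    Set.ncard_lt_ncard (compl_lt_compl_iff_lt.2 (ssubset_insert hv)) (toFinite _)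
  by_cases h0 : ∅ ∈ minorEdges E W Z
  · exact Or.inl h0
  by_cases hne : (minorEdges E W Z).Nonempty
  swap
  · rw [not_nonempty_iff_eq_empty] at hne
    exact Or.inr ⟨[], by simp, by simp, by simp [hne]⟩
  by_cases h1 : ∃ v, {v} ∈ minorEdges E W Z
  · obtain ⟨v, hv⟩ := h1
    have hv' := hv
    obtain ⟨e, ⟨heE, heW⟩, hev⟩ := hv'
    have hve : v ∈ e \ Z := by
      have : v ∈ ({v} : Set (ι × Bool)) := rfl
      rwa [← hev] at this
    have hvW : v ∉ W := fun h => Set.disjoint_left.1 heW hve.1 h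
    have hsub : minorEdges E (insert v W) Z ⊆ minorEdges E W Z :=
      image_mono fun e he => ⟨he.1, he.2.mono_right (subset_insert _ _)⟩
    rcases ih _ (hlt v hvW) (insert v W) Z (disjoint_insert_left.2 ⟨hve.2, hWZ⟩) rfl with h | h
    · exact absurd (hsub h) h0
    · obtain ⟨L, hL, hd, hc⟩ := h
      refine Or.inr ⟨(v, {v}) :: L, ?_, ?_, ?_⟩
      · intro x hx
        rcases List.mem_cons.1 hx with rfl | hx
        · exact hv
        · exact hsub (hL x hx)
      · refine List.pairwise_cons.2 ⟨fun x hx => ?_, hd⟩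
        obtain ⟨f, ⟨-, hf⟩, hfx⟩ := hL x hx
        rw [disjoint_singleton_left, ← hfx]
        exact fun h => Set.disjoint_left.1 hf h.1 (mem_insert _ _)
      · intro f hf
        by_cases hvf : v ∈ f
        · exact ⟨_, List.mem_cons_self, hvf⟩
        · obtain ⟨g, ⟨hg, hgW⟩, rfl⟩ := hf
          obtain ⟨x, hx, hxg⟩ := hc (g \ Z)
            ⟨g, ⟨hg, disjoint_insert_right.2 ⟨fun h => hvf ⟨h, hve.2⟩, hgW⟩⟩, rfl⟩
          exact ⟨x, List.mem_cons_of_mem _ hx, hxg⟩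
  by_cases h2 : ∃ v ∉ W, ∀ e ∈ E, Disjoint e W → v ∉ e
  · obtain ⟨v, hvW, hv⟩ := h2
    -- `v` may be contracted; taking it out of `Z` keeps the two sets disjoint and changes no
    -- surviving edge.
    have heq : minorEdges E (insert v W) (Z \ {v}) = minorEdges E W Z := by
      have hset : {e | e ∈ E ∧ Disjoint e (insert v W)} = {e | e ∈ E ∧ Disjoint e W} := by
        ext e
        simp only [mem_ofPred_eq, disjoint_insert_right]
        exact ⟨fun h => ⟨h.1, h.2.2⟩, fun h => ⟨h.1, hv e h.1 h.2, h.2⟩⟩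
      unfold minorEdges
      rw [hset]
      refine image_congr fun e he => ?_
      ext w
      have : w ∈ e → w ≠ v := fun h h' => hv e he.1 he.2 (h' ▸ h)
      simp only [mem_sdiff, mem_singleton_iff]
      tauto
    rw [← heq]
    refine ih _ (hlt v hvW) _ _ ?_ rfl
    exact disjoint_insert_left.2 ⟨fun h => h.2 rfl, hWZ.mono_right sdiff_subset⟩
  by_cases h3 : ∃ v ∈ W, antipode v ∉ Z
  · obtain ⟨v, hvW, hvZ⟩ := h3
    obtain ⟨e, he⟩ := hne
    refine Or.inr (Certified.of_list [(antipode v, e)] (by simp) ?_)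
    rintro _ ⟨f, ⟨hf, hfW⟩, rfl⟩
    exact ⟨_, List.mem_cons_self,
      ⟨hE f hf v fun h => Set.disjoint_left.1 hfW h hvW, hvZ⟩, he⟩
  push Not at h1 h2 h3
  refine Or.inr (key W Z ⟨hWZ, h3, h2, hne, fun e he v hev => ?_⟩)
  rcases subset_singleton_iff_eq.1 hev with rfl | rfl
  · exact h0 he
  · exact h1 v he

theorem hasPackingProperty_of_reduced {ι : Type*} [Finite ι] {H : Hypergraph (ι × Bool)}
    (hE : ∀ e ∈ H.edgeSet, ∀ v, v ∉ e → antipode v ∈ e)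
    (key : ∀ W Z, IsReduced H.edgeSet W Z → Certified (minorEdges H.edgeSet W Z)) :
    H.HasPackingProperty := by
  rintro _ ⟨W, Z, -, -, hWZ, rfl⟩
  exact packs_of_certified _ (minor_certified_of_reduced hE key W Z hWZ)

/-! ### Constant and non-constant blocks -/

open Classical in
/-- The value of a constant Boolean function, `none` for a non-constant one. -/
noncomputable def constClass {ι : Type*} (a : ι → Bool) : Option Bool :=
  if a = (fun _ => false) then some false else if a = (fun _ => true) then some true else none

theorem constClass_eq_some {ι : Type*} [Nonempty ι] {a : ι → Bool} {α : Bool} :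
    constClass a = some α ↔ a = fun _ => α := by
  have hne : (fun _ : ι => true) ≠ fun _ => false := fun h => by
    simpa using congrFun h (Classical.arbitrary ι)
  unfold constClass
  split_ifs with h₁ h₂ <;> cases α <;> simp_all
  exact fun h => hne h.symm

@[simp]
theorem constClass_const {ι : Type*} [Nonempty ι] (α : Bool) :
    constClass (fun _ : ι => α) = some α :=
  constClass_eq_some.2 rfl

theorem constClass_eq_none {ι : Type*} [Nonempty ι] {a : ι → Bool} :
    constClass a = none ↔ ∀ α, a ≠ fun _ => α := by
  rw [Option.eq_none_iff_forall_ne_some]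
  exact forall_congr' fun α => not_congr constClass_eq_some

theorem constClass_eq_none_of_ne {ι : Type*} {a : ι → Bool} {i j : ι} (h : a i ≠ a j) :
    constClass a = none := by
  have : Nonempty ι := ⟨i⟩
  exact constClass_eq_none.2 fun α hα => h (by rw [hα])

theorem constClass_not {ι : Type*} [Nonempty ι] (a : ι → Bool) :
    constClass (fun i => !a i) = (constClass a).map not := by
  rcases h : constClass a with _ | α
  · refine constClass_eq_none.2 fun α hα => constClass_eq_none.1 h (!α) (funext fun i => ?_)
    simpa using congrArg not (congrFun hα i)
  · rw [constClass_eq_some.1 h]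
    simp

/-- The possible shapes of a block of coordinates some of which are fixed: none is fixed; all the
fixed ones have the value `α` and several, one or no coordinates are free; both values occur among
the fixed coordinates. -/
inductive BlockKind
  | free
  | many (α : Bool)
  | one (α : Bool)
  | full (α : Bool)
  | mixed

namespace BlockKind

/-- The classes of the points of the block. -/
def classes : BlockKind → List (Option Bool)
  | free => [some false, some true, none]
  | many α => [some α, none]
  | one α => [some α, none]
  | full α => [some α]
  | mixed => [none]

/-- The classes of pairs of points of the block that differ in all free coordinates. -/
def pairs : BlockKind → List (Option Bool × Option Bool)
  | free => [(some false, some true), (some true, some false), (none, none)]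
  | many α => [(some α, none), (none, some α), (none, none)]
  | one α => [(some α, none), (none, some α)]
  | full α => [(some α, some α)]
  | mixed => [(none, none)]

/-- Classes outside of which there is a point in every set of points of the block on which no free
coordinate is constant. -/
def avoidable : BlockKind → List (Option Bool)
  | free => [some false, some true]
  | many α => [some α]
  | one α => [some α, none]
  | full _ => []
  | mixed => []

end BlockKind

/-- `a` and `a'` avoid the forbidden values `w` and differ wherever the coordinate is not fixed. -/
def Antipodal {ι : Type*} (w : ι → Bool → Prop) (a a' : ι → Bool) : Prop :=
  ∀ i, ¬ w i (a i) ∧ ¬ w i (a' i) ∧ (a i = a' i → w i (!a i))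

theorem Antipodal.symm {ι : Type*} {w : ι → Bool → Prop} {a a' : ι → Bool}
    (h : Antipodal w a a') : Antipodal w a' a := fun i =>
  ⟨(h i).2.1, (h i).1, fun e => e ▸ (h i).2.2 e.symm⟩

open Classical in
/-- The point that differs from `a` in all the coordinates that are not fixed. -/
noncomputable def flipFree {ι : Type*} (w : ι → Bool → Prop) (a : ι → Bool) : ι → Bool :=
  fun i => if w i (!a i) then a i else !a i

theorem antipodal_flipFree {ι : Type*} {w : ι → Bool → Prop} {a : ι → Bool}
    (ha : ∀ i, ¬ w i (a i)) : Antipodal w a (flipFree w a) := by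
  intro i
  unfold flipFree
  by_cases h : w i (!a i)
  · simp [h, ha i]
  · simp [h, ha i]

/-- The kind `k` describes the block of coordinates with forbidden values `w`. -/
structure BlockKind.Describes {ι : Type*} (k : BlockKind) (w : ι → Bool → Prop) : Prop where
  mem_classes : ∀ a : ι → Bool, (∀ i, ¬ w i (a i)) → constClass a ∈ k.classes
  exists_antipodal : ∀ x ∈ k.pairs, ∃ a a', constClass a = x.1 ∧ constClass a' = x.2 ∧
    Antipodal w a a'
  avoid : ∀ X : Set (ι → Bool), (∀ a ∈ X, ∀ i, ¬ w i (a i)) →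
    (∀ i v, ¬ w i v → ∃ a ∈ X, a i = v) → ∀ x ∈ k.avoidable, ∃ a ∈ X, constClass a ≠ x

/-- Flipping all coordinates swaps the two constants and preserves non-constancy; two distinct
coordinates provide a non-constant point. -/
theorem describes_free {ι : Type*} [Nontrivial ι] {w : ι → Bool → Prop}
    (hw : ∀ i v, ¬ w i v) : BlockKind.free.Describes w := by
  classical
  obtain ⟨i, j, hij⟩ := exists_pair_ne ι
  have hflip : ∀ a, flipFree w a = fun i => !a i := fun a => by
    funext i
    simp [flipFree, hw]
  refine ⟨fun a _ => ?_, fun x hx => ?_, fun X _ hX x hx => ?_⟩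
  · rcases constClass a with _ | _ | _ <;> simp [BlockKind.classes]
  · simp only [BlockKind.pairs, List.mem_cons, List.not_mem_nil, or_false] at hx
    rcases hx with rfl | rfl | rfl
    · exact ⟨_, _, constClass_const false, by simp [hflip], antipodal_flipFree fun i => hw i _⟩
    · exact ⟨_, _, constClass_const true, by simp [hflip], antipodal_flipFree fun i => hw i _⟩
    · refine ⟨fun k => decide (k = i), _, constClass_eq_none_of_ne (i := i) (j := j) ?_,
        constClass_eq_none_of_ne (i := i) (j := j) ?_, antipodal_flipFree fun i => hw i _⟩ <;>
      simp [hflip, hij.symm]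
  · simp only [BlockKind.avoidable, List.mem_cons, List.not_mem_nil, or_false] at hx
    rcases hx with rfl | rfl
    · obtain ⟨a, ha, hai⟩ := hX i true (hw _ _)
      refine ⟨a, ha, fun h => ?_⟩
      rw [constClass_eq_some.1 h] at hai
      simp at hai
    · obtain ⟨a, ha, hai⟩ := hX i false (hw _ _)
      refine ⟨a, ha, fun h => ?_⟩
      rw [constClass_eq_some.1 h] at hai
      simp at hai

theorem describes_mixed {ι : Type*} {w : ι → Bool → Prop}
    (hw : ∀ i v, w i v → ¬ w i (!v)) {i j : ι} (hi : w i false) (hj : w j true) :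
    BlockKind.mixed.Describes w := by
  classical
  have key : ∀ a : ι → Bool, (∀ i, ¬ w i (a i)) → constClass a = none := by
    intro a ha
    refine constClass_eq_none_of_ne (i := i) (j := j) fun h => ?_
    have h1 : a i = true := by
      by_contra hc
      exact ha i (by rwa [Bool.eq_false_of_not_eq_true hc])
    have h2 : a j = false := by
      by_contra hc
      exact ha j (by rwa [Bool.eq_true_of_not_eq_false hc])
    simp [h1, h2] at h
  refine ⟨fun a ha => by simp [key a ha, BlockKind.classes], fun x hx => ?_,
    fun X _ _ x hx => by simp [BlockKind.avoidable] at hx⟩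
  -- This point takes the forced value where there is one, and `false` elsewhere.
  have ha : ∀ i, ¬ w i (decide (w i false)) := by
    intro i hi
    by_cases h : w i false
    · exact hw i false h (by simpa [h] using hi)
    · simp [h] at hi
  simp only [BlockKind.pairs, List.mem_cons, List.not_mem_nil, or_false] at hx
  subst hx
  exact ⟨_, _, key _ ha, key _ fun i => (antipodal_flipFree ha i).2.1, antipodal_flipFree ha⟩

/-- Coordinate `i₀` is stuck at `α`, so `α` is the only possible constant. The kind records whether
none, one or several coordinates can also take the value `!α`. -/
theorem exists_describes_of_fixed {ι : Type*} {w : ι → Bool → Prop} {α : Bool} {i₀ : ι}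
    (hi₀ : w i₀ (!α)) (hw : ∀ i, ¬ w i α) : ∃ k : BlockKind, k.Describes w := by
  classical
  have : Nonempty ι := ⟨i₀⟩
  have hne : ∀ a : ι → Bool, (∀ i, ¬ w i (a i)) → a i₀ = α := fun a ha => by
    by_contra hc
    exact ha i₀ (by rwa [Bool.eq_not_of_ne hc])
  have hcl : ∀ a : ι → Bool, (∀ i, ¬ w i (a i)) → constClass a = some α ∨ constClass a = none := by
    intro a ha
    by_cases h : a = fun _ => α
    · exact Or.inl (constClass_eq_some.2 h)
    · refine Or.inr (constClass_eq_none.2 fun β hβ => h ?_)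
      have := hne a ha
      rw [hβ] at this ⊢
      simp only at this
      rw [this]
  have hav : ∀ (X : Set (ι → Bool)), (∀ i v, ¬ w i v → ∃ a ∈ X, a i = v) →
      ∀ i, ¬ w i (!α) → ∃ a ∈ X, constClass a ≠ some α := by
    intro X hX i hi
    obtain ⟨a, ha, hai⟩ := hX i (!α) hi
    refine ⟨a, ha, fun h => ?_⟩
    rw [constClass_eq_some.1 h] at hai
    simp at hai
  have hconst := antipodal_flipFree (w := w) (a := fun _ => α) hw
  have hflip₀ : flipFree w (fun _ => α) i₀ = α := by simp [flipFree, hi₀]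
  by_cases hone : ∃ i, ¬ w i (!α)
  swap
  · push Not at hone
    have hall : ∀ a : ι → Bool, (∀ i, ¬ w i (a i)) → constClass a = some α := fun a ha =>
      constClass_eq_some.2 <| funext fun i => by
        by_contra hc
        exact ha i (by rw [Bool.eq_not_of_ne hc]; exact hone i)
    refine ⟨.full α, fun a ha => by simp [hall a ha, BlockKind.classes], fun x hx => ?_,
      fun X _ _ x hx => by simp [BlockKind.avoidable] at hx⟩
    simp only [BlockKind.pairs, List.mem_cons, List.not_mem_nil, or_false] at hx
    subst hx
    exact ⟨_, _, constClass_const α, hall _ fun i => (hconst i).2.1, hconst⟩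
  obtain ⟨i, hi⟩ := hone
  have hflip : constClass (flipFree w fun _ => α) = none :=
    constClass_eq_none_of_ne (i := i) (j := i₀) (by rw [hflip₀]; simp [flipFree, hi])
  by_cases htwo : ∃ j, j ≠ i ∧ ¬ w j (!α)
  · obtain ⟨j, hji, hj⟩ := htwo
    refine ⟨.many α, fun a ha => by simpa [BlockKind.classes] using hcl a ha, fun x hx => ?_,
      fun X _ hX x hx => ?_⟩
    · simp only [BlockKind.pairs, List.mem_cons, List.not_mem_nil, or_false] at hx
      rcases hx with rfl | rfl | rfl
      · exact ⟨_, _, constClass_const α, hflip, hconst⟩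
      · exact ⟨_, _, hflip, constClass_const α, hconst.symm⟩
      -- Flip `i` alone. The antipode flips `j` but not `i`, and both points keep `α` at `i₀`, so
      -- neither is constant.
      · have ha : ∀ k, ¬ w k (if k = i then !α else α) := fun k => by
          split_ifs with h
          · exact h ▸ hi
          · exact hw k
        have hii₀ : i₀ ≠ i := fun h => hi (h ▸ hi₀)
        refine ⟨_, _, constClass_eq_none_of_ne (i := i) (j := i₀) ?_,
          constClass_eq_none_of_ne (i := j) (j := i₀) ?_, antipodal_flipFree ha⟩
        · simp [hii₀]
        · simp [flipFree, hji, hj, hii₀, hi₀]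
    · simp only [BlockKind.avoidable, List.mem_cons, List.not_mem_nil, or_false] at hx
      subst hx
      exact hav X hX i hi
  · push Not at htwo
    refine ⟨.one α, fun a ha => by simpa [BlockKind.classes] using hcl a ha, fun x hx => ?_,
      fun X hXw hX x hx => ?_⟩
    · simp only [BlockKind.pairs, List.mem_cons, List.not_mem_nil, or_false] at hx
      rcases hx with rfl | rfl
      · exact ⟨_, _, constClass_const α, hflip, hconst⟩
      · exact ⟨_, _, hflip, constClass_const α, hconst.symm⟩
    · simp only [BlockKind.avoidable, List.mem_cons, List.not_mem_nil, or_false] at hx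
      rcases hx with rfl | rfl
      · exact hav X hX i hi
      -- A point with value `α` at the only free coordinate is the constant `α`.
      · obtain ⟨a, ha, hai⟩ := hX i α (hw i)
        refine ⟨a, ha, fun h => constClass_eq_none.1 h α (funext fun j => ?_)⟩
        by_cases hj : j = i
        · rw [hj, hai]
        · by_contra hc
          exact hXw a ha j (by rw [Bool.eq_not_of_ne hc]; exact htwo j hj)

theorem exists_describes {ι : Type*} [Nontrivial ι] {w : ι → Bool → Prop}
    (hw : ∀ i v, w i v → ¬ w i (!v)) : ∃ k : BlockKind, k.Describes w := by
  by_cases h0 : ∃ i, w i false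
  · obtain ⟨i, hi⟩ := h0
    by_cases h1 : ∃ j, w j true
    · obtain ⟨j, hj⟩ := h1
      exact ⟨_, describes_mixed hw hi hj⟩
    · push Not at h1
      exact exists_describes_of_fixed (α := true) (i₀ := i) hi h1
  · push Not at h0
    by_cases h1 : ∃ j, w j true
    · obtain ⟨j, hj⟩ := h1
      exact exists_describes_of_fixed (α := false) (i₀ := j) hj h0
    · push Not at h1
      exact ⟨_, describes_free fun i v => by cases v; exacts [h0 i, h1 i]⟩

/-! ### The pattern of the cuboids -/

/-- Membership of a point in terms of the classes of its two blocks and its last coordinate. The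
even corners belong to the set, the odd ones according to `u`; a point with exactly one constant
block belongs to it according to its last coordinate. -/
def pattern (lp lq : Bool → Bool) (u : Bool → Bool → Bool) :
    Option Bool → Option Bool → Bool → Bool
  | some α, some β, c => (xor (xor α β) c == false) || u α β
  | none, some _, c => lp c
  | some _, none, c => lq c
  | none, none, _ => false

/-- The two kinds of patterns considered. -/
def IsAdmissible (lp lq : Bool → Bool) (u : Bool → Bool → Bool) : Prop :=
  (lp = not ∧ lq = id ∧ ∃ α β, u α β = true) ∨ (lp = (fun _ => true) ∧ lq = fun _ => true)

/-- The values of a last coordinate that is free (`none`) or fixed. -/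
def lastValues : Option Bool → List Bool
  | none => [false, true]
  | some c => [c]

/-- The pairs of values of a last coordinate that differ if the coordinate is free. -/
def lastPairs : Option Bool → List (Bool × Bool)
  | none => [(false, true), (true, false)]
  | some c => [(c, c)]

/-- The triples of classes that satisfy `s` and are compatible with the given kinds. -/
def triples (s : Option Bool → Option Bool → Bool → Bool) (k l : BlockKind) (m : Option Bool) :
    List (Option Bool × Option Bool × Bool) :=
  (k.classes.product (l.classes.product (lastValues m))).filter fun t => s t.1 t.2.1 t.2.2

/-- Unless no triple is compatible or some free coordinate is constant, there are two
antipodal classes that satisfy `s`. -/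
def HasAntipodalClasses (s : Option Bool → Option Bool → Bool → Bool) (k l : BlockKind)
    (m : Option Bool) : Prop :=
  (∃ t ∈ triples s k l m, True) →
  (∀ x ∈ k.avoidable, ∃ t ∈ triples s k l m, t.1 ≠ x) →
  (∀ y ∈ l.avoidable, ∃ t ∈ triples s k l m, t.2.1 ≠ y) →
  (m = none → ∀ z : Bool, ∃ t ∈ triples s k l m, t.2.2 ≠ z) →
  ∃ x ∈ k.pairs, ∃ y ∈ l.pairs, ∃ z ∈ lastPairs m,
    s x.1 y.1 z.1 = true ∧ s x.2 y.2 z.2 = true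

/-- A Boolean version of `HasAntipodalClasses`. -/
def checkAntipodal (s : Option Bool → Option Bool → Bool → Bool) (k l : BlockKind)
    (m : Option Bool) : Bool :=
  (k.pairs.any fun x => l.pairs.any fun y => (lastPairs m).any fun z =>
    s x.1 y.1 z.1 && s x.2 y.2 z.2) ||
  (triples s k l m).isEmpty ||
  (k.avoidable.any fun x => (triples s k l m).all fun t => t.1 == x) ||
  (l.avoidable.any fun y => (triples s k l m).all fun t => t.2.1 == y) ||
  (m.isNone && [false, true].any fun z => (triples s k l m).all fun t => t.2.2 == z)

theorem hasAntipodalClasses_of_check {s : Option Bool → Option Bool → Bool → Bool}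
    {k l : BlockKind} {m : Option Bool} (h : checkAntipodal s k l m = true) :
    HasAntipodalClasses s k l m := by
  rintro ⟨t, ht, -⟩ hk hl hm
  simp only [checkAntipodal, Bool.or_eq_true, Bool.and_eq_true, List.any_eq_true, List.all_eq_true,
    List.isEmpty_iff, beq_iff_eq, Option.isNone_iff_eq_none] at h
  rcases h with (((h | h) | ⟨x, hx, h⟩) | ⟨y, hy, h⟩) | ⟨hm', z, -, h⟩
  · exact h
  · simp [h] at ht
  · obtain ⟨t, ht, hne⟩ := hk x hx
    exact absurd (h t ht) hne
  · obtain ⟨t, ht, hne⟩ := hl y hy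
    exact absurd (h t ht) hne
  · obtain ⟨t, ht, hne⟩ := hm hm' z
    exact absurd (h t ht) hne

/-- All the kinds of blocks. -/
def BlockKind.all : List BlockKind :=
  [free, many false, many true, one false, one true, full false, full true, mixed]

/-- The check for all kinds of blocks. -/
def checkAllAntipodal (s : Option Bool → Option Bool → Bool → Bool) : Bool :=
  BlockKind.all.all fun k => BlockKind.all.all fun l => [none, some false, some true].all fun m =>
    checkAntipodal s k l m

theorem hasAntipodalClasses_of_checkAll {s : Option Bool → Option Bool → Bool → Bool}
    (h : checkAllAntipodal s = true) (k l : BlockKind) (m : Option Bool) :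
    HasAntipodalClasses s k l m := by
  have hall : ∀ k : BlockKind, k ∈ BlockKind.all := by
    rintro (_ | (_ | _) | (_ | _) | (_ | _) | _) <;> simp [BlockKind.all]
  simp only [checkAllAntipodal, List.all_eq_true] at h
  refine hasAntipodalClasses_of_check (h k (hall k) l (hall l) m ?_)
  rcases m with _ | _ | _ <;> simp

/-- The function with the given four values. -/
def boolTable (u₁ u₂ u₃ u₄ : Bool) : Bool → Bool → Bool
  | false, false => u₁
  | false, true => u₂
  | true, false => u₃
  | true, true => u₄

theorem eq_boolTable (u : Bool → Bool → Bool) :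
    u = boolTable (u false false) (u false true) (u true false) (u true true) := by
  funext α β
  cases α <;> cases β <;> rfl

/-- The finite core of case (I): all shapes of a face against all nonempty sets of odd corners.
Without odd corners the check fails on the face with no fixed coordinate. -/
theorem checkAllAntipodal_not_id : ∀ u₁ u₂ u₃ u₄ : Bool, (u₁ || u₂ || u₃ || u₄) = true →
    checkAllAntipodal (pattern not id (boolTable u₁ u₂ u₃ u₄)) = true := by
  decide +kernel

theorem checkAllAntipodal_true : ∀ u₁ u₂ u₃ u₄ : Bool,
    checkAllAntipodal
      (pattern (fun _ => true) (fun _ => true) (boolTable u₁ u₂ u₃ u₄)) = true := by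
  decide +kernel

theorem IsAdmissible.hasAntipodalClasses {lp lq : Bool → Bool} {u : Bool → Bool → Bool}
    (h : IsAdmissible lp lq u) (k l : BlockKind) (m : Option Bool) :
    HasAntipodalClasses (pattern lp lq u) k l m := by
  refine hasAntipodalClasses_of_checkAll ?_ k l m
  rw [eq_boolTable u]
  rcases h with ⟨rfl, rfl, α, β, hu⟩ | ⟨rfl, rfl⟩
  · refine checkAllAntipodal_not_id _ _ _ _ ?_
    cases α <;> cases β <;> simp [hu]
  · exact checkAllAntipodal_true _ _ _ _

/-! ### Edges of a cuboid as points of a cube -/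

variable {ι κ : Type*}

/-- The edge of the cuboid at the point `(a, b, c)`. -/
def pointEdge (a : ι → Bool) (b : κ → Bool) (c : Bool) : Set ((ι ⊕ κ ⊕ Unit) × Bool) :=
  {v | Sum.elim a (Sum.elim b fun _ => c) v.1 = v.2}

@[simp]
theorem inl_mem_pointEdge {a : ι → Bool} {b : κ → Bool} {c : Bool} {i : ι} {t : Bool} :
    (Sum.inl i, t) ∈ pointEdge a b c ↔ a i = t := Iff.rfl

@[simp]
theorem inr_inl_mem_pointEdge {a : ι → Bool} {b : κ → Bool} {c : Bool} {j : κ} {t : Bool} :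
    (Sum.inr (Sum.inl j), t) ∈ pointEdge a b c ↔ b j = t := Iff.rfl

@[simp]
theorem inr_inr_mem_pointEdge {a : ι → Bool} {b : κ → Bool} {c t : Bool} {x : Unit} :
    (Sum.inr (Sum.inr x), t) ∈ pointEdge a b c ↔ c = t := Iff.rfl

theorem antipode_mem_pointEdge {a : ι → Bool} {b : κ → Bool} {c : Bool}
    {v : (ι ⊕ κ ⊕ Unit) × Bool} : antipode v ∈ pointEdge a b c ↔ v ∉ pointEdge a b c :=
  Bool.eq_not

/-- The edges of the cuboid of a pattern `s`. -/
def patternEdges (s : Option Bool → Option Bool → Bool → Bool) :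
    Set (Set ((ι ⊕ κ ⊕ Unit) × Bool)) :=
  {e | ∃ a b c, s (constClass a) (constClass b) c = true ∧ pointEdge a b c = e}

/-- The point `(a, b, c)` has a surviving edge after deletion of `W`. -/
def Survives (s : Option Bool → Option Bool → Bool → Bool) (W : Set ((ι ⊕ κ ⊕ Unit) × Bool))
    (a : ι → Bool) (b : κ → Bool) (c : Bool) : Prop :=
  s (constClass a) (constClass b) c = true ∧ (∀ i, (Sum.inl i, a i) ∉ W) ∧
    (∀ j, (Sum.inr (Sum.inl j), b j) ∉ W) ∧ (Sum.inr (Sum.inr ()), c) ∉ W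

theorem disjoint_pointEdge {W : Set ((ι ⊕ κ ⊕ Unit) × Bool)} {a : ι → Bool} {b : κ → Bool}
    {c : Bool} : Disjoint (pointEdge a b c) W ↔ (∀ i, (Sum.inl i, a i) ∉ W) ∧
      (∀ j, (Sum.inr (Sum.inl j), b j) ∉ W) ∧ (Sum.inr (Sum.inr ()), c) ∉ W := by
  rw [Set.disjoint_left]
  constructor
  · exact fun h => ⟨fun i => h rfl, fun j => h rfl, h rfl⟩
  · rintro ⟨ha, hb, hc⟩ ⟨i | j | ⟨⟩, t⟩ ht
    · exact (inl_mem_pointEdge.1 ht) ▸ ha i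
    · exact (inr_inl_mem_pointEdge.1 ht) ▸ hb j
    · exact (inr_inr_mem_pointEdge.1 ht) ▸ hc

theorem disjoint_pointEdge_sdiff {Z : Set ((ι ⊕ κ ⊕ Unit) × Bool)} {a a' : ι → Bool}
    {b b' : κ → Bool} {c c' : Bool} (ha : ∀ i, a i = a' i → (Sum.inl i, a i) ∈ Z)
    (hb : ∀ j, b j = b' j → (Sum.inr (Sum.inl j), b j) ∈ Z)
    (hc : c = c' → (Sum.inr (Sum.inr ()), c) ∈ Z) :
    Disjoint (pointEdge a b c \ Z) (pointEdge a' b' c' \ Z) := by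
  rw [Set.disjoint_left]
  rintro ⟨i | j | ⟨⟩, t⟩ ⟨he, heZ⟩ ⟨hf, -⟩
  · obtain rfl : a i = t := he
    exact heZ (ha i (Eq.symm hf))
  · obtain rfl : b j = t := he
    exact heZ (hb j (Eq.symm hf))
  · obtain rfl : c = t := he
    exact heZ (hc (Eq.symm hf))

theorem pointEdge_sdiff_subset_singleton {Z : Set ((ι ⊕ κ ⊕ Unit) × Bool)} {a : ι → Bool}
    {b : κ → Bool} {c : Bool} {v : (ι ⊕ κ ⊕ Unit) × Bool}
    (ha : ∀ i, (Sum.inl i, a i) ∈ Z ∨ (Sum.inl i, a i) = v)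
    (hb : ∀ j, (Sum.inr (Sum.inl j), b j) ∈ Z ∨ (Sum.inr (Sum.inl j), b j) = v)
    (hc : (Sum.inr (Sum.inr ()), c) ∈ Z ∨ (Sum.inr (Sum.inr ()), c) = v) :
    pointEdge a b c \ Z ⊆ {v} := by
  rintro ⟨i | j | ⟨⟩, t⟩ ⟨he, heZ⟩
  · obtain rfl : a i = t := he
    exact (ha i).resolve_left heZ
  · obtain rfl : b j = t := he
    exact (hb j).resolve_left heZ
  · obtain rfl : c = t := he
    exact hc.resolve_left heZ

theorem mem_minorEdges_patternEdges {s : Option Bool → Option Bool → Bool → Bool}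
    {W Z : Set ((ι ⊕ κ ⊕ Unit) × Bool)} {e : Set ((ι ⊕ κ ⊕ Unit) × Bool)} :
    e ∈ minorEdges (patternEdges s) W Z ↔
      ∃ a b c, Survives s W a b c ∧ pointEdge a b c \ Z = e := by
  constructor
  · rintro ⟨_, ⟨⟨a, b, c, hs, rfl⟩, hW⟩, rfl⟩
    exact ⟨a, b, c, ⟨hs, disjoint_pointEdge.1 hW⟩, rfl⟩
  · rintro ⟨a, b, c, hs, rfl⟩
    exact ⟨_, ⟨⟨a, b, c, hs.1, rfl⟩, disjoint_pointEdge.2 hs.2⟩, rfl⟩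

theorem Survives.mem {s : Option Bool → Option Bool → Bool → Bool}
    {W Z : Set ((ι ⊕ κ ⊕ Unit) × Bool)} {a : ι → Bool} {b : κ → Bool} {c : Bool}
    (h : Survives s W a b c) : pointEdge a b c \ Z ∈ minorEdges (patternEdges s) W Z :=
  mem_minorEdges_patternEdges.2 ⟨a, b, c, h, rfl⟩

/-- Every vertex that is not deleted lies on the edge of a surviving point. -/
theorem IsReduced.exists_survives {s : Option Bool → Option Bool → Bool → Bool}
    {W Z : Set ((ι ⊕ κ ⊕ Unit) × Bool)} (h : IsReduced (patternEdges s) W Z)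
    {v : (ι ⊕ κ ⊕ Unit) × Bool} (hv : v ∉ W) :
    ∃ a b c, Survives s W a b c ∧ v ∈ pointEdge a b c := by
  obtain ⟨_, ⟨a, b, c, hs, rfl⟩, hW, hve⟩ := h.exists_edge v hv
  exact ⟨a, b, c, ⟨hs, disjoint_pointEdge.1 hW⟩, hve⟩

/-! ### Two disjoint edges -/

/-- A coordinate is fixed if one of its vertices is deleted, and then its other vertex is
contracted. Two surviving points that differ in all unfixed coordinates therefore have disjoint
edges. Since survival depends on the face and the classes only, the finite check provides them. -/
theorem IsReduced.exists_disjoint [Nontrivial ι] [Nontrivial κ] {lp lq : Bool → Bool}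
    {u : Bool → Bool → Bool} (hs : IsAdmissible lp lq u) {W Z : Set ((ι ⊕ κ ⊕ Unit) × Bool)}
    (h : IsReduced (patternEdges (pattern lp lq u)) W Z) :
    ∃ e ∈ minorEdges (patternEdges (pattern lp lq u)) W Z,
      ∃ f ∈ minorEdges (patternEdges (pattern lp lq u)) W Z, Disjoint e f := by
  have hanti : ∀ (x : ι ⊕ κ ⊕ Unit) t, (x, t) ∈ W → (x, !t) ∉ W := fun x t ht ht' =>
    Set.disjoint_left.1 h.disjoint ht' (h.antipode_mem _ ht)
  obtain ⟨k, hk⟩ := exists_describes (w := fun (i : ι) t => (Sum.inl i, t) ∈ W)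
    fun i t => hanti _ t
  obtain ⟨l, hl⟩ := exists_describes (w := fun (j : κ) t => (Sum.inr (Sum.inl j), t) ∈ W)
    fun j t => hanti _ t
  obtain ⟨m, hm, hmp, hmn⟩ : ∃ m : Option Bool,
      (∀ c, (Sum.inr (Sum.inr ()), c) ∉ W → c ∈ lastValues m) ∧
      (∀ z ∈ lastPairs m, (Sum.inr (Sum.inr ()), z.1) ∉ W ∧ (Sum.inr (Sum.inr ()), z.2) ∉ W ∧
        (z.1 = z.2 → (Sum.inr (Sum.inr ()), !z.1) ∈ W)) ∧
      (m = none → ∀ c, (Sum.inr (Sum.inr ()), c) ∉ W) := by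
    by_cases hr : ∃ c, (Sum.inr (Sum.inr ()), c) ∈ W
    · obtain ⟨c, hc⟩ := hr
      refine ⟨some (!c), fun d hd => ?_, fun z hz => ?_, by simp⟩
      · simp only [lastValues, List.mem_cons, List.not_mem_nil, or_false]
        exact Bool.eq_not_of_ne fun e => hd (e ▸ hc)
      · simp only [lastPairs, List.mem_cons, List.not_mem_nil, or_false] at hz
        subst hz
        exact ⟨hanti _ _ hc, hanti _ _ hc, fun _ => by simpa using hc⟩
    · push Not at hr
      refine ⟨none, fun d _ => by cases d <;> simp [lastValues], fun z hz => ?_, fun _ => hr⟩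
      refine ⟨hr _, hr _, fun e => ?_⟩
      simp only [lastPairs, List.mem_cons, List.not_mem_nil, or_false] at hz
      rcases hz with rfl | rfl <;> simp at e
  have htr : ∀ a b c, Survives (pattern lp lq u) W a b c →
      (constClass a, constClass b, c) ∈ triples (pattern lp lq u) k l m := fun a b c hS =>
    List.mem_filter.2 ⟨List.mem_product.2 ⟨hk.mem_classes a hS.2.1, List.mem_product.2
      ⟨hl.mem_classes b hS.2.2.1, hm c hS.2.2.2⟩⟩, hS.1⟩
  -- The hypotheses of the check: some point survives, and each free coordinate takes both values on
  -- the surviving points.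
  obtain ⟨x, hx, y, hy, z, hz, h1, h2⟩ := hs.hasAntipodalClasses k l m
    (by
      obtain ⟨e, he⟩ := h.nonempty
      obtain ⟨a, b, c, hS, -⟩ := mem_minorEdges_patternEdges.1 he
      exact ⟨_, htr a b c hS, trivial⟩)
    (fun x hx => by
      obtain ⟨a, ⟨b, c, hS⟩, ha⟩ := hk.avoid {a | ∃ b c, Survives (pattern lp lq u) W a b c}
        (fun a ⟨b, c, hS⟩ => hS.2.1)
        (fun i v hv => by
          obtain ⟨a, b, c, hS, hi⟩ := h.exists_survives hv
          exact ⟨a, ⟨b, c, hS⟩, hi⟩) x hx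
      exact ⟨_, htr a b c hS, ha⟩)
    (fun x hx => by
      obtain ⟨b, ⟨a, c, hS⟩, hb⟩ := hl.avoid {b | ∃ a c, Survives (pattern lp lq u) W a b c}
        (fun b ⟨a, c, hS⟩ => hS.2.2.1)
        (fun i v hv => by
          obtain ⟨a, b, c, hS, hi⟩ := h.exists_survives hv
          exact ⟨b, ⟨a, c, hS⟩, hi⟩) x hx
      exact ⟨_, htr a b c hS, hb⟩)
    (fun hmn' z => by
      obtain ⟨a, b, c, hS, hc⟩ := h.exists_survives (hmn hmn' (!z))
      refine ⟨_, htr a b c hS, ?_⟩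
      rw [show c = !z from hc]
      simp)
  obtain ⟨a, a', ha, ha', haa⟩ := hk.exists_antipodal x hx
  obtain ⟨b, b', hb, hb', hbb⟩ := hl.exists_antipodal y hy
  obtain ⟨hc, hc', hcc⟩ := hmp z hz
  refine ⟨_, Survives.mem (a := a) (b := b) (c := z.1)
    ⟨by rw [ha, hb]; exact h1, fun i => (haa i).1, fun j => (hbb j).1, hc⟩,
    _, Survives.mem (a := a') (b := b') (c := z.2)
    ⟨by rw [ha', hb']; exact h2, fun i => (haa i).2.1, fun j => (hbb j).2.1, hc'⟩, ?_⟩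
  have hZ : ∀ (x : ι ⊕ κ ⊕ Unit) t, (x, !t) ∈ W → (x, t) ∈ Z := fun x t ht => by
    simpa [antipode] using h.antipode_mem _ ht
  exact disjoint_pointEdge_sdiff (fun i e => hZ _ _ ((haa i).2.2 e))
    (fun j e => hZ _ _ ((hbb j).2.2 e)) (fun e => hZ _ _ (hcc e))

/-! ### Minors in which every coordinate has a contracted vertex -/

theorem Certified.of_forall_eq {V : Type*} {E : Set (Set V)} (h0 : ∀ e ∈ E, e.Nonempty)
    (h : ∀ e ∈ E, ∀ f ∈ E, e = f) : Certified E := by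
  rcases E.eq_empty_or_nonempty with rfl | ⟨e, he⟩
  · exact .of_list [] (by simp) (by simp)
  · obtain ⟨v, hv⟩ := h0 e he
    exact .of_list [(v, e)] (by simp) fun f hf =>
      ⟨_, List.mem_cons_self, by rwa [h f hf e he], he⟩

theorem IsReduced.edge_nonempty [Nonempty ι] {E : Set (Set (ι × Bool))} {W Z : Set (ι × Bool)}
    (h : IsReduced E W Z) {e : Set (ι × Bool)} (he : e ∈ minorEdges E W Z) : e.Nonempty :=
  Set.nonempty_iff_ne_empty.2 fun h0 =>
    h.nontrivial e he (Classical.arbitrary _) (by simp [h0])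

/-- A surviving point has no edge with at most one vertex that is not contracted. -/
theorem IsReduced.not_survives {s : Option Bool → Option Bool → Bool → Bool}
    {W Z : Set ((ι ⊕ κ ⊕ Unit) × Bool)} (h : IsReduced (patternEdges s) W Z)
    {a : ι → Bool} {b : κ → Bool} {c : Bool} (v : (ι ⊕ κ ⊕ Unit) × Bool)
    (ha : ∀ i, (Sum.inl i, a i) ∈ Z ∨ (Sum.inl i, a i) = v)
    (hb : ∀ j, (Sum.inr (Sum.inl j), b j) ∈ Z ∨ (Sum.inr (Sum.inl j), b j) = v)
    (hc : (Sum.inr (Sum.inr ()), c) ∈ Z ∨ (Sum.inr (Sum.inr ()), c) = v) :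
    ¬ Survives s W a b c := fun hS =>
  h.nontrivial _ hS.mem v (pointEdge_sdiff_subset_singleton ha hb hc)

/-- Only odd corners can be missing, and changing the last coordinate of an odd corner gives an even
one. -/
theorem pattern_eq_true_of_ne {lp lq : Bool → Bool} {u : Bool → Bool → Bool} {α β γ c : Bool}
    (h : pattern lp lq u (some α) (some β) γ = false) (hc : c ≠ γ) :
    pattern lp lq u (some α) (some β) c = true := by
  obtain rfl := Bool.eq_not_of_ne hc
  revert h
  simp only [pattern]
  cases α <;> cases β <;> cases γ <;> simp

section Local

variable [Nontrivial ι] [Nontrivial κ] {lp lq : Bool → Bool} {u : Bool → Bool → Bool}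
  {W Z : Set ((ι ⊕ κ ⊕ Unit) × Bool)} {γ : Bool}

/-- Both blocks have a contracted constant point. -/
theorem IsReduced.certified_of_const_const (hs : IsAdmissible lp lq u)
    (h : IsReduced (patternEdges (pattern lp lq u)) W Z) {α β : Bool}
    (hα : ∀ i, (Sum.inl i, α) ∈ Z) (hβ : ∀ j, (Sum.inr (Sum.inl j), β) ∈ Z)
    (hγ : (Sum.inr (Sum.inr ()), γ) ∈ Z) :
    Certified (minorEdges (patternEdges (pattern lp lq u)) W Z) := by
  classical
  have hZW : ∀ v ∈ Z, v ∉ W := fun v hv hv' => Set.disjoint_left.1 h.disjoint hv' hv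
  have hcorner : pattern lp lq u (some α) (some β) γ = false := by
    by_contra hc
    exact h.not_survives (Sum.inr (Sum.inr ()), γ) (fun i => Or.inl (hα i))
      (fun j => Or.inl (hβ j)) (Or.inl hγ) ⟨by simpa using hc, fun i => hZW _ (hα i),
        fun j => hZW _ (hβ j), hZW _ hγ⟩
  -- The missing corner is odd, so `(α, β, !γ)` belongs to the pattern. Its edge would have at most
  -- the last vertex, so that vertex is deleted.
  have hr : ∀ c, (Sum.inr (Sum.inr ()), c) ∉ W → c = γ := by
    intro c hcW
    by_contra hc
    exact h.not_survives (Sum.inr (Sum.inr ()), c) (fun i => Or.inl (hα i))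
      (fun j => Or.inl (hβ j)) (Or.inr rfl) ⟨by simpa using pattern_eq_true_of_ne hcorner hc,
        fun i => hZW _ (hα i),
        fun j => hZW _ (hβ j), hcW⟩
  -- Changing one coordinate of the constant `α` gives a non-constant block, as another coordinate
  -- `j` keeps `α`. The resulting edge would have at most one vertex, so no such change survives.
  have hP : lp γ = true → ∀ a : ι → Bool, (∀ i, (Sum.inl i, a i) ∉ W) → a = fun _ => α := by
    intro hlp a ha
    funext i
    by_contra hi
    obtain ⟨j, hj⟩ := exists_ne i
    refine h.not_survives (a := Function.update (fun _ => α) i (a i)) (Sum.inl i, a i)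
      (fun k => ?_) (fun j => Or.inl (hβ j)) (Or.inl hγ) ⟨?_, fun k => ?_,
        fun j => hZW _ (hβ j), hZW _ hγ⟩
    · by_cases hk : k = i
      · subst hk; simp
      · simp [hk, hα k]
    · rw [constClass_eq_none_of_ne (i := i) (j := j) (by simpa [hj] using hi), constClass_const]
      exact hlp
    · by_cases hk : k = i
      · subst hk; simpa using ha k
      · simpa [hk] using hZW _ (hα k)
  have hQ : lq γ = true → ∀ b : κ → Bool, (∀ j, (Sum.inr (Sum.inl j), b j) ∉ W) →
      b = fun _ => β := by
    intro hlq b hb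
    funext i
    by_contra hi
    obtain ⟨j, hj⟩ := exists_ne i
    refine h.not_survives (b := Function.update (fun _ => β) i (b i)) (Sum.inr (Sum.inl i), b i)
      (fun i => Or.inl (hα i)) (fun k => ?_) (Or.inl hγ) ⟨?_, fun j => hZW _ (hα j),
        fun k => ?_, hZW _ hγ⟩
    · by_cases hk : k = i
      · subst hk; simp
      · simp [hk, hβ k]
    · rw [constClass_eq_none_of_ne (i := i) (j := j) (by simpa [hj] using hi), constClass_const]
      exact hlq
    · by_cases hk : k = i
      · subst hk; simpa using hb k
      · simpa [hk] using hZW _ (hβ k)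
  have hlpq : lp γ = true ∨ lq γ = true := by
    rcases hs with ⟨rfl, rfl, -⟩ | ⟨rfl, rfl⟩ <;> cases γ <;> simp
  -- One block is fixed at its contracted constant. The other must be the opposite constant, so at
  -- most one point survives.
  have hall : ∀ a b c, Survives (pattern lp lq u) W a b c → c = γ ∧
      ((lp γ = true ∧ a = (fun _ => α) ∧ b = fun _ => !β) ∨
        (lp γ = false ∧ a = (fun _ => !α) ∧ b = fun _ => β)) := by
    rintro a b c ⟨hS, ha, hb, hc⟩
    obtain rfl := hr c hc
    refine ⟨rfl, ?_⟩
    by_cases hlp : lp c = true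
    · obtain rfl := hP hlp a ha
      refine Or.inl ⟨hlp, rfl, ?_⟩
      rw [constClass_const] at hS
      rcases hb' : constClass b with _ | β'
      · rw [hb'] at hS
        obtain rfl := hQ hS b hb
        simp at hb'
      · obtain rfl := constClass_eq_some.1 hb'
        funext _
        refine Bool.eq_not_of_ne fun e => ?_
        rw [hb', e, hcorner] at hS
        simp at hS
    · obtain rfl := hQ (hlpq.resolve_left hlp) b hb
      refine Or.inr ⟨by simpa using hlp, ?_, rfl⟩
      rw [constClass_const] at hS
      rcases ha' : constClass a with _ | α'
      · rw [ha'] at hS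
        exact absurd hS hlp
      · obtain rfl := constClass_eq_some.1 ha'
        funext _
        refine Bool.eq_not_of_ne fun e => ?_
        rw [ha', e, hcorner] at hS
        simp at hS
  refine .of_forall_eq (fun e he => h.edge_nonempty he) fun e he f hf => ?_
  obtain ⟨a, b, c, hS, rfl⟩ := mem_minorEdges_patternEdges.1 he
  obtain ⟨a', b', c', hS', rfl⟩ := mem_minorEdges_patternEdges.1 hf
  obtain ⟨rfl, h1⟩ := hall _ _ _ hS
  obtain ⟨rfl, h2⟩ := hall _ _ _ hS'
  rcases h1 with ⟨h1, rfl, rfl⟩ | ⟨h1, rfl, rfl⟩ <;>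
    rcases h2 with ⟨h2, rfl, rfl⟩ | ⟨h2, rfl, rfl⟩
  · rfl
  · simp [h1] at h2
  · simp [h1] at h2
  · rfl

/-- The first block has a contracted constant point, the second one has none. -/
theorem IsReduced.certified_of_const_nonconst (hs : IsAdmissible lp lq u)
    (h : IsReduced (patternEdges (pattern lp lq u)) W Z) {α : Bool} {b₀ : κ → Bool}
    (hα : ∀ i, (Sum.inl i, α) ∈ Z) (hb₀ : ∀ j, (Sum.inr (Sum.inl j), b₀ j) ∈ Z)
    (hβ : ∀ β, ∃ j, (Sum.inr (Sum.inl j), β) ∉ Z) (hγ : (Sum.inr (Sum.inr ()), γ) ∈ Z) :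
    Certified (minorEdges (patternEdges (pattern lp lq u)) W Z) := by
  have hZW : ∀ v ∈ Z, v ∉ W := fun v hv hv' => Set.disjoint_left.1 h.disjoint hv' hv
  have hb₀' : constClass b₀ = none := constClass_eq_none.2 fun β e => by
    obtain ⟨j, hj⟩ := hβ β
    exact hj (by simpa [e] using hb₀ j)
  -- `b₀` is non-constant, so if `lq c` held, the edge of `(α, b₀, c)` would have at most the last
  -- vertex. This leaves only case (I) with last coordinate `false`, where the second block of every
  -- surviving point is constant.
  have hlq : ∀ c, (Sum.inr (Sum.inr ()), c) ∉ W → lq c = false := by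
    intro c hc
    by_contra hlq
    refine h.not_survives (a := fun _ => α) (b := b₀) (Sum.inr (Sum.inr ()), c)
      (fun i => Or.inl (hα i)) (fun j => Or.inl (hb₀ j)) (Or.inr rfl)
      ⟨?_, fun i => hZW _ (hα i), fun j => hZW _ (hb₀ j), hc⟩
    rw [hb₀', constClass_const]
    simpa [pattern] using hlq
  obtain ⟨rfl, rfl, -⟩ : lp = not ∧ lq = id ∧ ∃ α β, u α β = true := by
    rcases hs with h | ⟨-, rfl⟩
    · exact h
    · exact absurd (hlq γ (hZW _ hγ)) (by simp)
  obtain rfl : γ = false := hlq γ (hZW _ hγ)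
  have hall : ∀ a b c, Survives (pattern not id u) W a b c →
      c = false ∧ ∃ β, b = fun _ => β := by
    rintro a b c ⟨hS, -, -, hc⟩
    obtain rfl : c = false := hlq c hc
    refine ⟨rfl, ?_⟩
    rcases hb : constClass b with _ | β
    · rw [hb] at hS
      rcases ha : constClass a with _ | _ <;> simp [ha, pattern] at hS
    · exact ⟨β, constClass_eq_some.1 hb⟩
  obtain ⟨j, hj⟩ := hβ α
  obtain ⟨j', hj'⟩ := hβ (!α)
  -- `(α, α, false)` is an even corner, hence always in the pattern. Its edge keeps vertices of the
  -- second block only, so it is disjoint from every edge whose second block is `!α`.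
  have hfst : ∀ a, Survives (pattern not id u) W a (fun _ : κ => α) false →
      Survives (pattern not id u) W (fun _ : ι => α) (fun _ : κ => α) false := fun a hS =>
    ⟨by simp [pattern], fun i => hZW _ (hα i), hS.2.2⟩
  by_cases hex : ∃ a, Survives (pattern not id u) W a (fun _ : κ => !α) false
  · obtain ⟨a', ha'⟩ := hex
    refine .of_list [((Sum.inr (Sum.inl j), α), pointEdge (fun _ => α) (fun _ => α) false \ Z),
      ((Sum.inr (Sum.inl j'), !α), pointEdge a' (fun _ => !α) false \ Z)] ?_ fun e he => ?_
    · simp only [List.pairwise_cons, List.mem_cons, List.not_mem_nil, or_false, forall_eq,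
        List.Pairwise.nil, IsEmpty.forall_iff, implies_true, and_true]
      exact disjoint_pointEdge_sdiff (fun i _ => hα i) (fun _ e => by simp at e) fun _ => hγ
    · obtain ⟨a, b, c, hS, rfl⟩ := mem_minorEdges_patternEdges.1 he
      obtain ⟨rfl, β, rfl⟩ := hall a b c hS
      by_cases hβα : β = α
      · subst hβα
        exact ⟨_, List.mem_cons_self, ⟨rfl, hj⟩, (hfst a hS).mem⟩
      · obtain rfl := Bool.eq_not_of_ne hβα
        exact ⟨_, List.mem_cons_of_mem _ List.mem_cons_self, ⟨rfl, hj'⟩, ha'.mem⟩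
  · refine .of_list [((Sum.inr (Sum.inl j), α), pointEdge (fun _ => α) (fun _ => α) false \ Z)]
      (by simp) fun e he => ?_
    obtain ⟨a, b, c, hS, rfl⟩ := mem_minorEdges_patternEdges.1 he
    obtain ⟨rfl, β, rfl⟩ := hall a b c hS
    by_cases hβα : β = α
    · subst hβα
      exact ⟨_, List.mem_cons_self, ⟨rfl, hj⟩, (hfst a hS).mem⟩
    · obtain rfl := Bool.eq_not_of_ne hβα
      exact absurd ⟨a, hS⟩ hex

/-- The second block has a contracted constant point, the first one has none. -/
theorem IsReduced.certified_of_nonconst_const (hs : IsAdmissible lp lq u)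
    (h : IsReduced (patternEdges (pattern lp lq u)) W Z) {β : Bool} {a₀ : ι → Bool}
    (ha₀ : ∀ i, (Sum.inl i, a₀ i) ∈ Z) (hα : ∀ α, ∃ i, (Sum.inl i, α) ∉ Z)
    (hβ : ∀ j, (Sum.inr (Sum.inl j), β) ∈ Z) (hγ : (Sum.inr (Sum.inr ()), γ) ∈ Z) :
    Certified (minorEdges (patternEdges (pattern lp lq u)) W Z) := by
  have hZW : ∀ v ∈ Z, v ∉ W := fun v hv hv' => Set.disjoint_left.1 h.disjoint hv' hv
  have ha₀' : constClass a₀ = none := constClass_eq_none.2 fun α e => by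
    obtain ⟨i, hi⟩ := hα α
    exact hi (by simpa [e] using ha₀ i)
  have hlp : ∀ c, (Sum.inr (Sum.inr ()), c) ∉ W → lp c = false := by
    intro c hc
    by_contra hlp
    refine h.not_survives (a := a₀) (b := fun _ => β) (Sum.inr (Sum.inr ()), c)
      (fun i => Or.inl (ha₀ i)) (fun j => Or.inl (hβ j)) (Or.inr rfl)
      ⟨?_, fun i => hZW _ (ha₀ i), fun j => hZW _ (hβ j), hc⟩
    rw [ha₀', constClass_const]
    simpa [pattern] using hlp
  obtain ⟨rfl, rfl, -⟩ : lp = not ∧ lq = id ∧ ∃ α β, u α β = true := by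
    rcases hs with h | ⟨rfl, -⟩
    · exact h
    · exact absurd (hlp γ (hZW _ hγ)) (by simp)
  have hlp' : ∀ c, (Sum.inr (Sum.inr ()), c) ∉ W → c = true := fun c hc => by
    simpa using hlp c hc
  obtain rfl : γ = true := hlp' γ (hZW _ hγ)
  have hall : ∀ a b c, Survives (pattern not id u) W a b c →
      c = true ∧ ∃ α, a = fun _ => α := by
    rintro a b c ⟨hS, -, -, hc⟩
    obtain rfl : c = true := hlp' c hc
    refine ⟨rfl, ?_⟩
    rcases ha : constClass a with _ | α
    · rw [ha] at hS
      rcases hb : constClass b with _ | _ <;> simp [hb, pattern] at hS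
    · exact ⟨α, constClass_eq_some.1 ha⟩
  obtain ⟨i, hi⟩ := hα β
  obtain ⟨i', hi'⟩ := hα (!β)
  -- Here the last coordinate is `true`, and even corners have opposite blocks; hence `!β`.
  have hfst : ∀ b, Survives (pattern not id u) W (fun _ : ι => !β) b true →
      Survives (pattern not id u) W (fun _ : ι => !β) (fun _ : κ => β) true := fun b hS =>
    ⟨by simp [pattern], hS.2.1, fun j => hZW _ (hβ j), hS.2.2.2⟩
  by_cases hex : ∃ b, Survives (pattern not id u) W (fun _ : ι => β) b true
  · obtain ⟨b', hb'⟩ := hex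
    refine .of_list [((Sum.inl i', !β), pointEdge (fun _ => !β) (fun _ => β) true \ Z),
      ((Sum.inl i, β), pointEdge (fun _ => β) b' true \ Z)] ?_ fun e he => ?_
    · simp only [List.pairwise_cons, List.mem_cons, List.not_mem_nil, or_false, forall_eq,
        List.Pairwise.nil, IsEmpty.forall_iff, implies_true, and_true]
      exact disjoint_pointEdge_sdiff (fun _ e => by simp at e) (fun j _ => hβ j) fun _ => hγ
    · obtain ⟨a, b, c, hS, rfl⟩ := mem_minorEdges_patternEdges.1 he
      obtain ⟨rfl, α, rfl⟩ := hall a b c hS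
      by_cases hβα : α = β
      · subst hβα
        exact ⟨_, List.mem_cons_of_mem _ List.mem_cons_self, ⟨rfl, hi⟩, hb'.mem⟩
      · obtain rfl := Bool.eq_not_of_ne hβα
        exact ⟨_, List.mem_cons_self, ⟨rfl, hi'⟩, (hfst b hS).mem⟩
  · refine .of_list [((Sum.inl i', !β), pointEdge (fun _ => !β) (fun _ => β) true \ Z)]
      (by simp) fun e he => ?_
    obtain ⟨a, b, c, hS, rfl⟩ := mem_minorEdges_patternEdges.1 he
    obtain ⟨rfl, α, rfl⟩ := hall a b c hS
    by_cases hβα : α = β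
    · subst hβα
      exact absurd ⟨b, hS⟩ hex
    · obtain rfl := Bool.eq_not_of_ne hβα
      exact ⟨_, List.mem_cons_self, ⟨rfl, hi'⟩, (hfst b hS).mem⟩

/-- No block has a contracted constant point. -/
theorem IsReduced.certified_of_nonconst_nonconst (hs : IsAdmissible lp lq u)
    (h : IsReduced (patternEdges (pattern lp lq u)) W Z) {a₀ : ι → Bool} {b₀ : κ → Bool}
    (ha₀ : ∀ i, (Sum.inl i, a₀ i) ∈ Z) (hα : ∀ α, ∃ i, (Sum.inl i, α) ∉ Z)
    (hb₀ : ∀ j, (Sum.inr (Sum.inl j), b₀ j) ∈ Z) (hβ : ∀ β, ∃ j, (Sum.inr (Sum.inl j), β) ∉ Z)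
    (hγ : (Sum.inr (Sum.inr ()), γ) ∈ Z) :
    Certified (minorEdges (patternEdges (pattern lp lq u)) W Z) := by
  have hZW : ∀ v ∈ Z, v ∉ W := fun v hv hv' => Set.disjoint_left.1 h.disjoint hv' hv
  have ha₀' : constClass a₀ = none := constClass_eq_none.2 fun α e => by
    obtain ⟨i, hi⟩ := hα α
    exact hi (by simpa [e] using ha₀ i)
  have hb₀' : constClass b₀ = none := constClass_eq_none.2 fun β e => by
    obtain ⟨j, hj⟩ := hβ β
    exact hj (by simpa [e] using hb₀ j)
  choose i hi using hα
  choose j hj using hβ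
  -- A constant block of a surviving point may be completed by the contracted point of the other
  -- block. Apart from the last coordinate, the new edge has vertices in the constant block only.
  have hSP : ∀ {b c c' α}, lq c = true → (Sum.inr (Sum.inr ()), c) ∉ W →
      Survives (pattern lp lq u) W (fun _ : ι => α) b c' →
      Survives (pattern lp lq u) W (fun _ : ι => α) b₀ c := fun {b c c' α} hc hcW hS =>
    ⟨by rwa [hb₀', constClass_const], hS.2.1, fun j => hZW _ (hb₀ j), hcW⟩
  have hSQ : ∀ {a c c' β}, lp c = true → (Sum.inr (Sum.inr ()), c) ∉ W →
      Survives (pattern lp lq u) W a (fun _ : κ => β) c' →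
      Survives (pattern lp lq u) W a₀ (fun _ : κ => β) c := fun {a c c' β} hc hcW hS =>
    ⟨by rwa [ha₀', constClass_const], fun i => hZW _ (ha₀ i), hS.2.2.1, hcW⟩
  have hQQ : ∀ c, (Sum.inr (Sum.inr ()), c) ∈ Z →
      Disjoint (pointEdge a₀ (fun _ => false) c \ Z) (pointEdge a₀ (fun _ => true) c \ Z) :=
    fun c hc => disjoint_pointEdge_sdiff (fun i _ => ha₀ i) (fun _ e => by simp at e) fun _ => hc
  have hPP : ∀ c, (Sum.inr (Sum.inr ()), c) ∈ Z →
      Disjoint (pointEdge (fun _ => false) b₀ c \ Z) (pointEdge (fun _ => true) b₀ c \ Z) :=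
    fun c hc => disjoint_pointEdge_sdiff (fun _ e => by simp at e) (fun j _ => hb₀ j) fun _ => hc
  have hPQ : ∀ c c' α β, ((Sum.inr (Sum.inr ()), c) ∈ Z ∨ c ≠ c') →
      Disjoint (pointEdge (fun _ => α) b₀ c \ Z) (pointEdge a₀ (fun _ => β) c' \ Z) :=
    fun c c' α β hc => disjoint_pointEdge_sdiff (fun i e => e ▸ ha₀ i) (fun j _ => hb₀ j)
      fun e => hc.resolve_right fun h => h e
  -- If suitable last vertices are contracted, the completions of the four constants are pairwise
  -- disjoint. Every surviving point has a constant block, which selects its covering vertex.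
  by_cases hfour : (∃ c, (Sum.inr (Sum.inr ()), c) ∈ Z ∧ lq c = true) ∧
      ∃ c, (Sum.inr (Sum.inr ()), c) ∈ Z ∧ lp c = true
  · obtain ⟨⟨c, hcZ, hc⟩, c', hcZ', hc'⟩ := hfour
    refine .of_list [((Sum.inl (i false), false), pointEdge (fun _ => false) b₀ c \ Z),
      ((Sum.inl (i true), true), pointEdge (fun _ => true) b₀ c \ Z),
      ((Sum.inr (Sum.inl (j false)), false), pointEdge a₀ (fun _ => false) c' \ Z),
      ((Sum.inr (Sum.inl (j true)), true), pointEdge a₀ (fun _ => true) c' \ Z)] ?_ fun e he => ?_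
    · simp [hPP c hcZ, hQQ c' hcZ', hPQ c c' _ _ (Or.inl hcZ)]
    · obtain ⟨a, b, d, hS, rfl⟩ := mem_minorEdges_patternEdges.1 he
      rcases ha : constClass a with _ | α
      · rcases hb : constClass b with _ | β
        · exact absurd hS.1 (by simp [ha, hb, pattern])
        · obtain rfl := constClass_eq_some.1 hb
          have hmem := (hSQ hc' (hZW _ hcZ') hS).mem (Z := Z)
          cases β
          · exact ⟨_, List.mem_cons_of_mem _ (List.mem_cons_of_mem _ List.mem_cons_self),
              ⟨rfl, hj false⟩, hmem⟩
          · exact ⟨_,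
              List.mem_cons_of_mem _ (List.mem_cons_of_mem _ (List.mem_cons_of_mem _ List.mem_cons_self)),
              ⟨rfl, hj true⟩, hmem⟩
      · obtain rfl := constClass_eq_some.1 ha
        have hmem := (hSP hc (hZW _ hcZ) hS).mem (Z := Z)
        cases α
        · exact ⟨_, List.mem_cons_self, ⟨rfl, hi false⟩, hmem⟩
        · exact ⟨_, List.mem_cons_of_mem _ List.mem_cons_self, ⟨rfl, hi true⟩, hmem⟩
  obtain ⟨rfl, rfl, -⟩ : lp = not ∧ lq = id ∧ ∃ α β, u α β = true := by
    rcases hs with h | ⟨rfl, rfl⟩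
    · exact h
    · exact absurd ⟨⟨γ, hγ, rfl⟩, γ, hγ, rfl⟩ hfour
  have hP : ∀ a b, Survives (pattern not id u) W a b true → ∃ α, a = fun _ => α := by
    intro a b hS
    rcases ha : constClass a with _ | α
    · rcases hb : constClass b with _ | β <;> exact absurd hS.1 (by simp [ha, hb, pattern])
    · exact ⟨α, constClass_eq_some.1 ha⟩
  have hQ : ∀ a b, Survives (pattern not id u) W a b false → ∃ β, b = fun _ => β := by
    intro a b hS
    rcases hb : constClass b with _ | β
    · rcases ha : constClass a with _ | α <;> exact absurd hS.1 (by simp [ha, hb, pattern])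
    · exact ⟨β, constClass_eq_some.1 hb⟩
  cases γ
  · have hr : (Sum.inr (Sum.inr ()), true) ∉ Z := fun hr => hfour ⟨⟨_, hr, rfl⟩, _, hγ, rfl⟩
    obtain ⟨f, hf, hf0, hf1⟩ : ∃ f, (∀ a b, Survives (pattern not id u) W a b true →
        f ∈ minorEdges (patternEdges (pattern not id u)) W Z) ∧
        Disjoint f (pointEdge a₀ (fun _ => false) false \ Z) ∧
        Disjoint f (pointEdge a₀ (fun _ => true) false \ Z) := by
      by_cases hex : ∃ a b, Survives (pattern not id u) W a b true
      · obtain ⟨a, b, hS⟩ := hex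
        obtain ⟨α, rfl⟩ := hP a b hS
        exact ⟨_, fun _ _ _ => (hSP rfl hS.2.2.2 hS).mem, hPQ _ _ _ _ (by simp),
          hPQ _ _ _ _ (by simp)⟩
      · exact ⟨∅, fun a b hS => absurd ⟨a, b, hS⟩ hex, by simp, by simp⟩
    refine .of_list [((Sum.inr (Sum.inr ()), true), f),
      ((Sum.inr (Sum.inl (j false)), false), pointEdge a₀ (fun _ => false) false \ Z),
      ((Sum.inr (Sum.inl (j true)), true), pointEdge a₀ (fun _ => true) false \ Z)]
      (by simp [hf0, hf1, hQQ false hγ]) fun e he => ?_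
    obtain ⟨a, b, c, hS, rfl⟩ := mem_minorEdges_patternEdges.1 he
    cases c
    · obtain ⟨β, rfl⟩ := hQ a b hS
      have hmem := (hSQ rfl (hZW _ hγ) hS).mem (Z := Z)
      cases β
      · exact ⟨_, List.mem_cons_of_mem _ List.mem_cons_self, ⟨rfl, hj false⟩, hmem⟩
      · exact ⟨_, List.mem_cons_of_mem _ (List.mem_cons_of_mem _ List.mem_cons_self),
          ⟨rfl, hj true⟩, hmem⟩
    · exact ⟨_, List.mem_cons_self, ⟨rfl, hr⟩, hf a b hS⟩
  · have hr : (Sum.inr (Sum.inr ()), false) ∉ Z := fun hr => hfour ⟨⟨_, hγ, rfl⟩, _, hr, rfl⟩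
    obtain ⟨f, hf, hf0, hf1⟩ : ∃ f, (∀ a b, Survives (pattern not id u) W a b false →
        f ∈ minorEdges (patternEdges (pattern not id u)) W Z) ∧
        Disjoint (pointEdge (fun _ => false) b₀ true \ Z) f ∧
        Disjoint (pointEdge (fun _ => true) b₀ true \ Z) f := by
      by_cases hex : ∃ a b, Survives (pattern not id u) W a b false
      · obtain ⟨a, b, hS⟩ := hex
        obtain ⟨β, rfl⟩ := hQ a b hS
        exact ⟨_, fun _ _ _ => (hSQ rfl hS.2.2.2 hS).mem, hPQ _ _ _ _ (by simp),
          hPQ _ _ _ _ (by simp)⟩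
      · exact ⟨∅, fun a b hS => absurd ⟨a, b, hS⟩ hex, by simp, by simp⟩
    refine .of_list [((Sum.inl (i false), false), pointEdge (fun _ => false) b₀ true \ Z),
      ((Sum.inl (i true), true), pointEdge (fun _ => true) b₀ true \ Z),
      ((Sum.inr (Sum.inr ()), false), f)]
      (by simp [hf0, hf1, hPP true hγ]) fun e he => ?_
    obtain ⟨a, b, c, hS, rfl⟩ := mem_minorEdges_patternEdges.1 he
    cases c
    · exact ⟨_, List.mem_cons_of_mem _ (List.mem_cons_of_mem _ List.mem_cons_self),
        ⟨rfl, hr⟩, hf a b hS⟩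
    · obtain ⟨α, rfl⟩ := hP a b hS
      have hmem := (hSP rfl (hZW _ hγ) hS).mem (Z := Z)
      cases α
      · exact ⟨_, List.mem_cons_self, ⟨rfl, hi false⟩, hmem⟩
      · exact ⟨_, List.mem_cons_of_mem _ List.mem_cons_self, ⟨rfl, hi true⟩, hmem⟩

theorem IsReduced.certified (hs : IsAdmissible lp lq u)
    (h : IsReduced (patternEdges (pattern lp lq u)) W Z) :
    Certified (minorEdges (patternEdges (pattern lp lq u)) W Z) := by
  by_cases hz : ∀ x, ∃ t, (x, t) ∈ Z
  · choose z hz using hz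
    by_cases hP : ∃ α, ∀ i, (Sum.inl i, α) ∈ Z
    · obtain ⟨α, hα⟩ := hP
      by_cases hQ : ∃ β, ∀ j, (Sum.inr (Sum.inl j), β) ∈ Z
      · obtain ⟨β, hβ⟩ := hQ
        exact h.certified_of_const_const hs hα hβ (hz _)
      · push Not at hQ
        exact h.certified_of_const_nonconst hs hα (fun j => hz _) hQ (hz _)
    · push Not at hP
      by_cases hQ : ∃ β, ∀ j, (Sum.inr (Sum.inl j), β) ∈ Z
      · obtain ⟨β, hβ⟩ := hQ
        exact h.certified_of_nonconst_const hs (fun i => hz _) hP hβ (hz _)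
      · push Not at hQ
        exact h.certified_of_nonconst_nonconst hs (fun i => hz _) hP (fun j => hz _) hQ (hz _)
  · push Not at hz
    obtain ⟨x, hx⟩ := hz
    -- Neither vertex over `x` is contracted and every edge contains one of them, so two disjoint
    -- edges settle the case.
    obtain ⟨e, he, f, hf, hef⟩ := h.exists_disjoint hs
    refine .of_list [((x, true), e), ((x, false), f)] (by simpa using hef) fun g hg => ?_
    obtain ⟨a, b, c, hS, rfl⟩ := mem_minorEdges_patternEdges.1 hg
    by_cases hxt : (x, true) ∈ pointEdge a b c
    · exact ⟨_, List.mem_cons_self, ⟨hxt, hx true⟩, he⟩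
    · exact ⟨_, List.mem_cons_of_mem _ List.mem_cons_self,
        ⟨antipode_mem_pointEdge.2 hxt, hx false⟩, hf⟩

end Local

theorem hasPackingProperty_of_patternEdges [Finite ι] [Finite κ] [Nontrivial ι] [Nontrivial κ]
    {lp lq : Bool → Bool} {u : Bool → Bool → Bool} (hs : IsAdmissible lp lq u)
    {H : Hypergraph ((ι ⊕ κ ⊕ Unit) × Bool)} (hH : H.edgeSet = patternEdges (pattern lp lq u)) :
    H.HasPackingProperty := by
  refine hasPackingProperty_of_reduced ?_ ?_
  · rw [hH]
    rintro _ ⟨a, b, c, -, rfl⟩ v hv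
    exact antipode_mem_pointEdge.2 hv
  · rw [hH]
    exact fun W Z h => h.certified hs

/-! ### The hypergraphs `Q_{pq}^F` as cuboids -/

section Translation

variable {p q : ℕ}

theorem mem_starSet {S : Set (Vertex p q)} {x : Fin p ⊕ Fin q ⊕ Unit} {t : Bool} :
    (x, t) ∈ starSet S ↔ (x, !t) ∈ S := by
  constructor
  · rintro ⟨⟨y, s⟩, hv, h⟩
    simp only [star, Prod.mk.injEq] at h
    obtain ⟨rfl, rfl⟩ := h
    simpa using hv
  · exact fun h => ⟨_, h, by simp [star]⟩

theorem mem_pSet {A : Set (Fin p)} {x : Fin p ⊕ Fin q ⊕ Unit} {t : Bool} :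
    (x, t) ∈ pSet q A ↔ ∃ i ∈ A, Sum.inl i = x ∧ false = t := by
  simp [pSet]

theorem mem_qSet {B : Set (Fin q)} {x : Fin p ⊕ Fin q ⊕ Unit} {t : Bool} :
    (x, t) ∈ qSet p B ↔ ∃ j ∈ B, Sum.inr (Sum.inl j) = x ∧ false = t := by
  simp [qSet]

theorem mem_R {x : Fin p ⊕ Fin q ⊕ Unit} {t : Bool} :
    (x, t) ∈ R p q ↔ x = Sum.inr (Sum.inr ()) ∧ t = false := by
  simp [R]

theorem starSet_starSet (S : Set (Vertex p q)) : starSet (starSet S) = S := by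
  ext ⟨x, t⟩
  simp [mem_starSet]

theorem starSet_pointEdge (a : Fin p → Bool) (b : Fin q → Bool) (c : Bool) :
    starSet (pointEdge a b c) = pointEdge (fun i => !a i) (fun j => !b j) (!c) := by
  ext ⟨i | j | ⟨⟩, t⟩ <;> rw [mem_starSet] <;> simp [Bool.not_eq_eq_eq_not]

theorem mem_starFamily {F : Set (Set (Vertex p q))} {e : Set (Vertex p q)} :
    e ∈ starFamily F ↔ starSet e ∈ F := by
  constructor
  · rintro ⟨f, hf, rfl⟩
    rwa [starSet_starSet]
  · exact fun h => ⟨_, h, starSet_starSet e⟩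

theorem pointEdge_inj {a a' : Fin p → Bool} {b b' : Fin q → Bool} {c c' : Bool}
    (h : pointEdge a b c = pointEdge a' b' c') : a = a' ∧ b = b' ∧ c = c' := by
  refine ⟨funext fun i => ?_, funext fun j => ?_, ?_⟩
  · have : (Sum.inl i, a i) ∈ pointEdge a' b' c' := h ▸ inl_mem_pointEdge.2 rfl
    exact (inl_mem_pointEdge.1 this).symm
  · have : (Sum.inr (Sum.inl j), b j) ∈ pointEdge a' b' c' := h ▸ inr_inl_mem_pointEdge.2 rfl
    exact (inr_inl_mem_pointEdge.1 this).symm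
  · have : (Sum.inr (Sum.inr ()), c) ∈ pointEdge a' b' c' := h ▸ inr_inr_mem_pointEdge.2 rfl
    exact (inr_inr_mem_pointEdge.1 this).symm

-- The condition `A ≠ ∅` excludes only the first block that is constantly `!β`, and `B ≠ ∅` only the
-- second block that is constantly `α`. The excluded points are odd corners.
open Classical in
theorem mem_edges {e : Set (Vertex p q)} : e ∈ edges p q ↔
    (∃ a β, (a ≠ fun _ => !β) ∧ e = pointEdge a (fun _ => β) false) ∨
      ∃ α b, (b ≠ fun _ => α) ∧ e = pointEdge (fun _ => α) b true := by
  have h₁ : ∀ A : Set (Fin p), pSet q A ∪ starSet (pSet q Aᶜ) ∪ Q p q ∪ R p q =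
      pointEdge (fun i => decide (i ∉ A)) (fun _ => false) false := by
    intro A
    ext ⟨i | j | ⟨⟩, t⟩ <;> cases t <;> simp [mem_starSet, mem_pSet, mem_qSet, mem_R, Q]
  have h₂ : ∀ A : Set (Fin p), pSet q Aᶜ ∪ starSet (pSet q A) ∪ starSet (Q p q) ∪ R p q =
      pointEdge (fun i => decide (i ∈ A)) (fun _ => true) false := by
    intro A
    ext ⟨i | j | ⟨⟩, t⟩ <;> cases t <;> simp [mem_starSet, mem_pSet, mem_qSet, mem_R, Q]
  have h₃ : ∀ B : Set (Fin q), P p q ∪ qSet p Bᶜ ∪ starSet (qSet p B) ∪ starSet (R p q) =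
      pointEdge (fun _ => false) (fun j => decide (j ∈ B)) true := by
    intro B
    ext ⟨i | j | ⟨⟩, t⟩ <;> cases t <;> simp [mem_starSet, mem_pSet, mem_qSet, mem_R, P]
  have h₄ : ∀ B : Set (Fin q), starSet (P p q) ∪ qSet p B ∪ starSet (qSet p Bᶜ) ∪
      starSet (R p q) = pointEdge (fun _ => true) (fun j => decide (j ∉ B)) true := by
    intro B
    ext ⟨i | j | ⟨⟩, t⟩ <;> cases t <;> simp [mem_starSet, mem_pSet, mem_qSet, mem_R, P]
  simp only [edges, h₁, h₂, h₃, h₄, mem_union, mem_ofPred_eq]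
  constructor
  · rintro (((⟨A, ⟨i, hi⟩, rfl⟩ | ⟨A, ⟨i, hi⟩, rfl⟩) | ⟨B, ⟨j, hj⟩, rfl⟩) | ⟨B, ⟨j, hj⟩, rfl⟩)
    · exact Or.inl ⟨_, _, fun h => by simpa [hi] using congrFun h i, rfl⟩
    · exact Or.inl ⟨_, _, fun h => by simpa [hi] using congrFun h i, rfl⟩
    · exact Or.inr ⟨_, _, fun h => by simpa [hj] using congrFun h j, rfl⟩
    · exact Or.inr ⟨_, _, fun h => by simpa [hj] using congrFun h j, rfl⟩
  · rintro (⟨a, β, ha, rfl⟩ | ⟨α, b, hb, rfl⟩)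
    · obtain ⟨i, hi⟩ := Function.ne_iff.1 ha
      cases β
      · exact Or.inl (Or.inl (Or.inl ⟨{i | a i = false}, ⟨i, by simpa using hi⟩, by simp⟩))
      · exact Or.inl (Or.inl (Or.inr ⟨{i | a i = true}, ⟨i, by simpa using hi⟩, by simp⟩))
    · obtain ⟨j, hj⟩ := Function.ne_iff.1 hb
      cases α
      · exact Or.inl (Or.inr ⟨{j | b j = true}, ⟨j, by simpa using hj⟩, by simp⟩)
      · exact Or.inr ⟨{j | b j = false}, ⟨j, by simpa using hj⟩, by simp⟩

theorem mem_specialEdges {e : Set (Vertex p q)} : e ∈ specialEdges p q ↔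
    ∃ α β, e = pointEdge (fun _ => α) (fun _ => β) (xor α β) := by
  have h₁ : P p q ∪ Q p q ∪ R p q = pointEdge (fun _ => false) (fun _ => false) false := by
    ext ⟨i | j | ⟨⟩, t⟩ <;> cases t <;> simp [mem_pSet, mem_qSet, mem_R, P, Q]
  have h₂ : starSet (P p q) ∪ starSet (Q p q) ∪ R p q =
      pointEdge (fun _ => true) (fun _ => true) false := by
    ext ⟨i | j | ⟨⟩, t⟩ <;> cases t <;> simp [mem_starSet, mem_pSet, mem_qSet, mem_R, P, Q]
  have h₃ : P p q ∪ starSet (Q p q) ∪ starSet (R p q) =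
      pointEdge (fun _ => false) (fun _ => true) true := by
    ext ⟨i | j | ⟨⟩, t⟩ <;> cases t <;> simp [mem_starSet, mem_pSet, mem_qSet, mem_R, P, Q]
  have h₄ : starSet (P p q) ∪ Q p q ∪ starSet (R p q) =
      pointEdge (fun _ => true) (fun _ => false) true := by
    ext ⟨i | j | ⟨⟩, t⟩ <;> cases t <;> simp [mem_starSet, mem_pSet, mem_qSet, mem_R, P, Q]
  simp only [specialEdges, h₁, h₂, h₃, h₄, mem_insert_iff, mem_singleton_iff, Bool.exists_bool]
  simp only [Bool.false_xor, Bool.true_xor, Bool.not_true, Bool.not_false]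
  tauto

variable [NeZero p] [NeZero q]

theorem const_mem_edges (α β : Bool) :
    pointEdge (fun _ => α) (fun _ => β) (xor α β) ∈ edges p q := by
  rw [mem_edges]
  by_cases h : α = β
  · subst h
    refine Or.inl ⟨_, _, fun h => ?_, by rw [Bool.xor_self]⟩
    simpa using congrFun h 0
  · obtain rfl := Bool.eq_not_of_ne h
    refine Or.inr ⟨!β, fun _ => β, fun h => ?_, by simp⟩
    simpa using congrFun h 0

theorem edges_subset_patternEdges {lp lq : Bool → Bool} (hlp : lp false = true)
    (hlq : lq true = true) (u : Bool → Bool → Bool) :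
    edges p q ⊆ patternEdges (pattern lp lq u) := by
  intro e he
  rcases mem_edges.1 he with ⟨a, β, ha, rfl⟩ | ⟨α, b, hb, rfl⟩
  · refine ⟨_, _, _, ?_, rfl⟩
    rw [constClass_const]
    rcases ha' : constClass a with _ | α
    · exact hlp
    · obtain rfl := constClass_eq_some.1 ha'
      have : α ≠ !β := fun h => ha (by rw [h])
      revert this
      cases α <;> cases β <;> simp [pattern]
  · refine ⟨_, _, _, ?_, rfl⟩
    rw [constClass_const]
    rcases hb' : constClass b with _ | β
    · exact hlq
    · obtain rfl := constClass_eq_some.1 hb'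
      have : β ≠ α := fun h => hb (by rw [h])
      revert this
      cases α <;> cases β <;> simp [pattern]

open Classical in
/-- Adding odd corners to `E_{pq}`. -/
theorem edges_union_eq_patternEdges {F : Set (Set (Vertex p q))}
    (hF : F ⊆ starFamily (specialEdges p q)) :
    edges p q ∪ F = patternEdges (pattern not id fun α β =>
      decide (pointEdge (fun _ => α) (fun _ => β) (!xor α β) ∈ F)) := by
  refine Subset.antisymm (union_subset (edges_subset_patternEdges rfl rfl _) fun e he => ?_) ?_
  · obtain ⟨α, β, h⟩ := mem_specialEdges.1 (mem_starFamily.1 (hF he))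
    have h' := congrArg starSet h
    rw [starSet_starSet, starSet_pointEdge] at h'
    subst h'
    -- Complementing both blocks preserves their sum while the last coordinate flips, so the
    -- antipode of an even corner is odd.
    have hxor : xor (!α) (!β) = xor α β := by simp
    refine ⟨_, _, _, ?_, rfl⟩
    simp only [constClass_const, pattern, hxor, Bool.or_eq_true, decide_eq_true_eq]
    exact Or.inr he
  · rintro _ ⟨a, b, c, hs, rfl⟩
    rcases ha : constClass a with _ | α
    · rcases hb : constClass b with _ | β
      · simp [ha, hb, pattern] at hs
      · obtain rfl := constClass_eq_some.1 hb
        obtain rfl : c = false := by simpa [ha, pattern] using hs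
        exact Or.inl (mem_edges.2 (Or.inl ⟨_, _, constClass_eq_none.1 ha _, rfl⟩))
    · obtain rfl := constClass_eq_some.1 ha
      rcases hb : constClass b with _ | β
      · obtain rfl : c = true := by simpa [hb, pattern] using hs
        exact Or.inl (mem_edges.2 (Or.inr ⟨_, _, constClass_eq_none.1 hb _, rfl⟩))
      · obtain rfl := constClass_eq_some.1 hb
        by_cases hc : c = xor α β
        · subst hc
          exact Or.inl (const_mem_edges α β)
        · obtain rfl := Bool.eq_not_of_ne hc
          right
          simpa [pattern] using hs

open Classical in
/-- Adding all the antipodes but some odd corners to `E_{pq}`. -/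
theorem edges_union_starFamily_eq_patternEdges {F' : Set (Set (Vertex p q))}
    (hF : F' ⊆ specialEdges p q) :
    edges p q ∪ starFamily (edges p q \ F') = patternEdges (pattern (fun _ => true)
      (fun _ => true) fun α β =>
        decide (pointEdge (fun _ => !α) (fun _ => !β) (xor α β) ∉ F')) := by
  have hcorner : ∀ α β, pointEdge (fun _ => !α) (fun _ => !β) (xor α β) ∉ F' →
      pointEdge (fun _ => α) (fun _ => β) (!xor α β) ∈ starFamily (edges p q \ F') := by
    intro α β h
    rw [mem_starFamily, starSet_pointEdge, Bool.not_not]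
    exact ⟨by simpa using const_mem_edges (p := p) (q := q) (!α) (!β), h⟩
  -- `F'` consists of corners, so removing it does not affect points with a non-constant block.
  have hnone : ∀ {a b c}, constClass a = none ∨ constClass b = none →
      starSet (pointEdge a b c) ∉ F' := by
    intro a b c h hmem
    obtain ⟨α, β, he⟩ := mem_specialEdges.1 (hF hmem)
    have he' := congrArg starSet he
    rw [starSet_starSet, starSet_pointEdge] at he'
    obtain ⟨rfl, rfl, -⟩ := pointEdge_inj he'
    simp at h
  refine Subset.antisymm (union_subset (edges_subset_patternEdges rfl rfl _) fun e he => ?_) ?_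
  · obtain ⟨f, ⟨hf, hfF⟩, rfl⟩ := he
    -- Viewing `f` in the pattern without odd corners shows that it has a constant block and that it
    -- is even if it is a corner.
    obtain ⟨a, b, c, hs, rfl⟩ := edges_subset_patternEdges (lp := not) (lq := id) rfl rfl
      (fun _ _ => false) hf
    rw [starSet_pointEdge]
    refine ⟨_, _, _, ?_, rfl⟩
    rw [constClass_not, constClass_not]
    rcases ha : constClass a with _ | α
    · rcases hb : constClass b with _ | β
      · simp [ha, hb, pattern] at hs
      · rfl
    · rcases hb : constClass b with _ | β
      · rfl
      · obtain rfl := constClass_eq_some.1 ha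
        obtain rfl := constClass_eq_some.1 hb
        obtain rfl : xor α β = c := by
          revert hs
          cases α <;> cases β <;> cases c <;> simp [pattern]
        simp [pattern, hfF]
  · rintro _ ⟨a, b, c, hs, rfl⟩
    rcases ha : constClass a with _ | α
    · rcases hb : constClass b with _ | β
      · simp [ha, hb, pattern] at hs
      · obtain rfl := constClass_eq_some.1 hb
        cases c
        · exact Or.inl (mem_edges.2 (Or.inl ⟨_, _, constClass_eq_none.1 ha _, rfl⟩))
        · refine Or.inr (mem_starFamily.2 ⟨?_, hnone (Or.inl ha)⟩)
          rw [starSet_pointEdge]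
          refine mem_edges.2 (Or.inl ⟨_, _, constClass_eq_none.1 ?_ _, rfl⟩)
          rw [constClass_not, ha, Option.map_none]
    · obtain rfl := constClass_eq_some.1 ha
      rcases hb : constClass b with _ | β
      · cases c
        · refine Or.inr (mem_starFamily.2 ⟨?_, hnone (Or.inr hb)⟩)
          rw [starSet_pointEdge]
          refine mem_edges.2 (Or.inr ⟨_, _, constClass_eq_none.1 ?_ _, rfl⟩)
          rw [constClass_not, hb, Option.map_none]
        · exact Or.inl (mem_edges.2 (Or.inr ⟨_, _, constClass_eq_none.1 hb _, rfl⟩))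
      · obtain rfl := constClass_eq_some.1 hb
        by_cases hc : c = xor α β
        · subst hc
          exact Or.inl (const_mem_edges α β)
        · obtain rfl := Bool.eq_not_of_ne hc
          exact Or.inr (hcorner α β (by simpa [pattern] using hs))

end Translation

end QClutter

theorem mainTheorem2 (p q : ℕ) (hp : 1 < p) (hq : 1 < q) :
    (∀ F : Set (Set (QClutter.Vertex p q)),
      F ⊆ QClutter.starFamily (QClutter.specialEdges p q) → F.Nonempty →
        (QClutter.QF p q F).HasPackingProperty) ∧
    (∀ F' : Set (Set (QClutter.Vertex p q)),
      F' ⊆ QClutter.specialEdges p q → F'.Nonempty →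
        (QClutter.QF p q
          (QClutter.starFamily (QClutter.edges p q \ F'))).HasPackingProperty) := by
  have : Nontrivial (Fin p) := Fin.nontrivial_iff_two_le.2 hp
  have : Nontrivial (Fin q) := Fin.nontrivial_iff_two_le.2 hq
  have : NeZero p := ⟨by omega⟩
  have : NeZero q := ⟨by omega⟩
  constructor
  · intro F hF hne
    refine QClutter.hasPackingProperty_of_patternEdges (Or.inl ⟨rfl, rfl, ?_⟩)
      (QClutter.edges_union_eq_patternEdges hF)
    obtain ⟨e, he⟩ := hne
    obtain ⟨α, β, h⟩ := QClutter.mem_specialEdges.1 (QClutter.mem_starFamily.1 (hF he))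
    have h' := congrArg QClutter.starSet h
    rw [QClutter.starSet_starSet, QClutter.starSet_pointEdge] at h'
    -- The chosen member of `F` is the antipode of the even corner at `(α, β)`, so it is the odd
    -- corner at `(!α, !β)`.
    refine ⟨!α, !β, ?_⟩
    subst h'
    simpa using he
  · intro F' hF' _
    exact QClutter.hasPackingProperty_of_patternEdges (Or.inr ⟨rfl, rfl⟩)
      (QClutter.edges_union_starFamily_eq_patternEdges hF')
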